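/- **Setting.** For a probability measure $\pi$ on $[0,\infty)$ let $(\theta_1,X_1),\dots,(\theta_n,X_n)$ be i.i.d. with $\theta_i\sim\pi$ and $X_i\mid\theta_i\sim\mathrm{Poi}(\theta_i)$. For a function $\ell$ put $$\mathsf{mmse}_\ell(\pi)=\inf_{t:\mathbb Z_{\ge0}\to\mathbb R}\mathbb E\big[(t(X_1)-\ell(\theta_1))^2\big],$$ and for an estimator $\hat T=(\hat T_1,\dots,\hat T_n):\mathbb Z_{\ge0}^n\to\mathbb R^n$ put $$\mathsf{TotRegret}_{\pi,\ell,n}(\hat T)=\mathbb E\Big[\sum_{j=1}^n\big(\hat T_j(X_1,\dots,X_n)-\ell(\theta_j)\big)^2\Big]-n\,\mathsf{mmse}_\ell(\pi).$$ Let $\mathcal P([0,h])$ be the set of probability measures $\pi$ with $\pi([0,h])=1$, and $$\mathsf{TotRegret}_{\ell,n}(\mathcal P([0,h]))=\inf_{\hat T}\ \sup_{\pi\in\mathcal P([0,h])}\mathsf{TotRegret}_{\pi,\ell,n}(\hat T).$$ **Theorem (Poisson problem, smooth $\ell$).** Let $h>0$. 1. Let $p\ge0$ be an integer, $0<\alpha\le1$,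 $\beta=p+\alpha$, and let $L,M$ be real numbers. There is a constant $C=C(L,M,h,\beta)>0$ such that for every $\ell$ with $\sup_{[0,h]}|\ell|\le M$ which is $p$ times continuously differentiable on $[0,h]$ with $|\ell^{(p)}(x)-\ell^{(p)}(y)|\le L|x-y|^\alpha$ for all $x,y\in[0,h]$, and for all $n\ge3$, $$\mathsf{TotRegret}_{\ell,n}(\mathcal P([0,h]))\le C\,n\left(\frac{\log\log n}{\log n}\right)^{2\beta}.$$ 2. Let $R\in(h,\infty]$ and let $r$ be a real number with $h<r<R$. There are a constant $C_2>0$ depending only on $R,h,r$ and, for each $A\ge 0$, a constant $C_1(A)>0$ depending only on $R,h,r,A$, such that for every $\ell$ given on $[0,h]$ by a power series $\ell(\theta)=\sum_{m\ge0}a_m\theta^m$ with radius of convergence $R$, and for all $n\ge3$, $$\mathsf{TotRegret}_{\ell,n}(\mathcal P([0,h]))\le C_1(A_\ell)\,n^{1-\frac{C_2}{\log\log n}},\qquad A_\ell=\sup_{m\ge0}|a_m|r^m .$$ (Since $r<R$, the number $A_\ell$ is finite. Hence, for each such $\ell$, the bound is $O\big(n^{1-C_2/\log\log n}\big)$.)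 3. Let $D_1,D_2>0$. There are constants $C_1,C_2>0$ depending only on $D_1,D_2,h$ such that for every $\ell$ given on $[0,h]$ by a power series $\ell(\theta)=\sum_{m\ge0}a_m\theta^m$ with $|a_m|\le(D_1m)^{-D_2m}$ for all $m\ge1$, and for all $n\ge3$, $$\mathsf{TotRegret}_{\ell,n}(\mathcal P([0,h]))\le C_1\,n^{1-\min\{2D_2,1\}+\frac{C_2}{\log\log n}}.$$ In each part, for every such $n$ there is moreover an estimator $\hat T$ with $\sup_{\pi\in\mathcal P([0,h])}\mathsf{TotRegret}_{\pi,\ell,n}(\hat T)$ at most the stated right-hand side. -/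

import Mathlib

open MeasureTheory ProbabilityTheory Set Filter Topology
open scoped NNReal ENNReal

noncomputable section

namespace PoissonEB

/-- The Poisson model: the Markov kernel `θ ↦ Poi(θ)` from `[0, ∞)` to `ℕ`. -/
def poissonKernel : Kernel ℝ≥0 ℕ where
  toFun := poissonMeasure
  measurable' := by
    refine Measure.measurable_of_measurable_coe _ fun s _ => ?_
    simp only [poissonMeasure, Measure.sum_apply_of_countable, Measure.smul_apply, smul_eq_mul]
    fun_prop

instance : IsMarkovKernel poissonKernel :=
  ⟨fun θ => inferInstanceAs (IsProbabilityMeasure (poissonMeasure θ))⟩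

/-- The joint law of `(θ, X)` with `θ ∼ π` and `X ∣ θ ∼ Poi(θ)`. -/
def jointLaw (π : ProbabilityMeasure ℝ≥0) : Measure (ℝ≥0 × ℕ) :=
  (π : Measure ℝ≥0) ⊗ₘ poissonKernel

/-- The law of an i.i.d. sample `(θ₁, X₁), …, (θₙ, Xₙ)` from `jointLaw π`. -/
def sampleLaw (π : ProbabilityMeasure ℝ≥0) (n : ℕ) : Measure (Fin n → ℝ≥0 × ℕ) :=
  Measure.pi fun _ => jointLaw π

/-- The minimum mean squared error of estimating `ℓ(θ)` from a single `X`, the prior `π` being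
known: the infimum of `𝔼 (t(X) - ℓ(θ))²` over all estimators `t`. -/
def mmse (π : ProbabilityMeasure ℝ≥0) (ℓ : ℝ → ℝ) : ℝ≥0∞ :=
  ⨅ t : ℕ → ℝ, ∫⁻ z, ENNReal.ofReal ((t z.2 - ℓ z.1) ^ 2) ∂(jointLaw π)

/-- An `n`-letter to `n`-letter estimator. -/
abbrev Estimator (n : ℕ) : Type := (Fin n → ℕ) → Fin n → ℝ

/-- Total squared error `𝔼 ∑ⱼ (Tⱼ(X₁, …, Xₙ) - ℓ(θⱼ))²` of the estimator `T`. -/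
def totalRisk (π : ProbabilityMeasure ℝ≥0) (ℓ : ℝ → ℝ) {n : ℕ} (T : Estimator n) : ℝ≥0∞ :=
  ∫⁻ ω, ENNReal.ofReal (∑ j, (T (fun i => (ω i).2) j - ℓ (ω j).1) ^ 2) ∂(sampleLaw π n)

/-- Total regret of `T`: its total squared error minus `n` times the mmse. The values are
extended reals since an estimator may have infinite risk. -/
def totRegret (π : ProbabilityMeasure ℝ≥0) (ℓ : ℝ → ℝ) {n : ℕ} (T : Estimator n) : EReal :=
  (totalRisk π ℓ T : EReal) - (((n : ℝ≥0∞) * mmse π ℓ : ℝ≥0∞) : EReal)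

/-- Worst-case total regret of `T` over a class `G` of priors. -/
def maxTotRegret (G : Set (ProbabilityMeasure ℝ≥0)) (ℓ : ℝ → ℝ) {n : ℕ} (T : Estimator n) :
    EReal :=
  ⨆ π ∈ G, totRegret π ℓ T

/-- Minimax total regret over a class `G` of priors. -/
def minimaxTotRegret (G : Set (ProbabilityMeasure ℝ≥0)) (ℓ : ℝ → ℝ) (n : ℕ) : EReal :=
  ⨅ T : Estimator n, maxTotRegret G ℓ T

/-- The class `𝒫([0, h])` of priors supported on `[0, h]`. -/
def boundedPriors (h : ℝ) : Set (ProbabilityMeasure ℝ≥0) :=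
  {π | (π : Measure ℝ≥0) {θ | (θ : ℝ) ≤ h} = 1}

/-- `f` is Hölder continuous on `s` with exponent `α` and constant `L`. -/
def HolderOnReal (L α : ℝ) (f : ℝ → ℝ) (s : Set ℝ) : Prop :=
  ∀ x ∈ s, ∀ y ∈ s, |f x - f y| ≤ L * |x - y| ^ α

/-- The radius of convergence of the power series `∑ aₘ xᵐ`: the supremum in `[0, ∞]` of all
`r ≥ 0` for which `∑ aₘ rᵐ` converges. -/
def convergenceRadius (a : ℕ → ℝ) : ℝ≥0∞ :=
  ⨆ r ∈ {r : ℝ≥0 | ∃ s : ℝ,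
    Tendsto (fun N => ∑ m ∈ Finset.range N, a m * (r : ℝ) ^ m) atTop (𝓝 s)}, (r : ℝ≥0∞)

/-- `ℓ` is given on `[0, h]` by the power series `∑ aₘ θᵐ` about the origin. -/
def HasPowerSeriesOnIcc (ℓ : ℝ → ℝ) (a : ℕ → ℝ) (h : ℝ) : Prop :=
  ∀ θ ∈ Icc (0 : ℝ) h, HasSum (fun m => a m * θ ^ m) (ℓ θ)

/-- The minimax total regret over `𝒫([0, h])` at sample size `n` is at most `b`, and some
estimator has worst-case total regret at most `b`. -/
def RegretBound (h : ℝ) (ℓ : ℝ → ℝ) (n : ℕ) (b : ℝ) : Prop :=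
  minimaxTotRegret (boundedPriors h) ℓ n ≤ (b : EReal) ∧
    ∃ T : Estimator n, maxTotRegret (boundedPriors h) ℓ T ≤ (b : EReal)

end PoissonEB

end

namespace PoissonEB

/-! ### The Poisson mixture -/

/-! The engine is Robbins' identity `poissonWeight_add`: multiplying the Poisson weight at `x` by `θ
^ m` gives `(x+1)⋯(x+m)` times the weight at `x + m`. Hence, for a polynomial `P = ∑ bₘ θᵐ`, the
posterior mean of `P(θ)` given `X = x` is `∑ bₘ (x+1)⋯(x+m) f(x+m) / f(x)`, where `f` is the mixture
mass function. Replacing `f` by empirical frequencies and clipping the ratio gives an estimator that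
does not know the prior.

By the bias-variance identity, the regret of a rule `t` for one observation is `∑ₓ f(x) (t(x) -
𝔼[ℓ(θ) | x])²`. Estimating coordinate `j` from the other observations makes the rule independent of
`(θⱼ, Xⱼ)`, so this identity applies coordinate by coordinate. Replacing `ℓ` by `P` costs `ε²`, with
`ε` the uniform error on `[0, h]`. For the random ratio, `sq_mul_clip_ratio_sub_le` bounds `f(x)²`
times the squared error by squared deviations of linear statistics. Their means are `O(f(x)/n)`, so
dividing by `f(x)` leaves a bound free of any lower bound on `f(x)`. Summing over `x ≤ K` and using
the factorial tail of `f` yields `regretBound_of_approx`, of the form `n ε² + K (M² + V) + n M²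
h^(K+1)/(K+1)!`, with `V` the `varianceProxy` and constants suppressed.

The cutoff `K = κ` is the least integer with `n ≤ κ ^ κ`, of order `log n / log log n`. Then the
factorial tail is negligible, and a factor `c ^ κ` is only `n ^ (O(1) / log log n)`. What remains is
to balance `ε` against `V`: - Smooth `ℓ`: Jackson's theorem in degree proportional to `κ` gives `ε =
O(κ ^ (-β))`. Chebyshev's extremal property bounds the coefficients exponentially, so for degree at
most `κ / 2` the variance is at most about `κ ^ (κ / 2)`, up to `c ^ κ`, far below `n`. - Radius of
convergence above `h`: truncating the series at `κ / 2` gives `ε²` of order `(h / r) ^ κ`, with the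
same variance estimate. - Rapid decay: the series can be truncated at `κ` itself. Both `n ε²` and
the variance are then `n ^ (1 - min (2 D₂) 1)` up to a factor `c ^ κ`. -/

/-- The Poisson probability mass function. -/
noncomputable def poissonWeight (x : ℕ) (θ : ℝ≥0) : ℝ := Real.exp (-θ) * θ ^ x / x.factorial

lemma poissonWeight_nonneg (x : ℕ) (θ : ℝ≥0) : 0 ≤ poissonWeight x θ := by
  unfold poissonWeight; positivity

lemma measurable_poissonWeight (x : ℕ) : Measurable (poissonWeight x) := by
  unfold poissonWeight; fun_prop

lemma poissonWeight_le_one (x : ℕ) (θ : ℝ≥0) : poissonWeight x θ ≤ 1 := by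
  have h := poissonMeasure_real_singleton θ x
  rw [poissonWeight, ← h]
  exact measureReal_le_one

/-- Robbins' identity, from `(x + m)! = x! (x+1)⋯(x+m)`. It turns posterior moments of `θ` into
values of the mixture, which can be observed. -/
lemma poissonWeight_add (x m : ℕ) (θ : ℝ≥0) :
    (x + 1).ascFactorial m * poissonWeight (x + m) θ = θ ^ m * poissonWeight x θ := by
  have h : ((x.factorial * (x + 1).ascFactorial m : ℕ) : ℝ) = ((x + m).factorial : ℝ) := by
    rw [Nat.factorial_mul_ascFactorial]
  push_cast at h
  have hx : (x.factorial : ℝ) ≠ 0 := by positivity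
  have hm : ((x + m).factorial : ℝ) ≠ 0 := by positivity
  unfold poissonWeight
  field_simp
  rw [← h]
  ring

instance (π : ProbabilityMeasure ℝ≥0) : IsProbabilityMeasure (jointLaw π) := by
  unfold jointLaw; infer_instance

instance (π : ProbabilityMeasure ℝ≥0) (n : ℕ) : IsProbabilityMeasure (sampleLaw π n) := by
  unfold sampleLaw; infer_instance

lemma lintegral_jointLaw (π : ProbabilityMeasure ℝ≥0) {G : ℝ≥0 × ℕ → ℝ≥0∞} (hG : Measurable G) :
    ∫⁻ z, G z ∂(jointLaw π) =
      ∑' x, ∫⁻ θ, ENNReal.ofReal (poissonWeight x θ) * G (θ, x) ∂(π : Measure ℝ≥0) := by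
  rw [jointLaw, Measure.lintegral_compProd hG, ← lintegral_tsum]
  · refine lintegral_congr fun θ => ?_
    have : poissonKernel θ = poissonMeasure θ := rfl
    rw [this, poissonMeasure, lintegral_sum_measure]
    refine tsum_congr fun x => ?_
    rw [lintegral_smul_measure, lintegral_dirac]
    rfl
  · intro x
    have := (measurable_poissonWeight x).ennreal_ofReal
    fun_prop

/-- The mass function of the Poisson mixture with mixing law `π`. -/
noncomputable def mixture (π : ProbabilityMeasure ℝ≥0) (x : ℕ) : ℝ :=
  ∫ θ, poissonWeight x θ ∂(π : Measure ℝ≥0)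

/-- The posterior mean of `u(θ)` given `X = x`. -/
noncomputable def posteriorMean (π : ProbabilityMeasure ℝ≥0) (u : ℝ≥0 → ℝ) (x : ℕ) : ℝ :=
  (∫ θ, poissonWeight x θ * u θ ∂(π : Measure ℝ≥0)) / mixture π x

section Mixture

variable (π : ProbabilityMeasure ℝ≥0)

lemma integrable_poissonWeight_mul {u : ℝ≥0 → ℝ} (hu : Measurable u) {M : ℝ}
    (hM : ∀ᵐ θ ∂(π : Measure ℝ≥0), |u θ| ≤ M) (x : ℕ) :
    Integrable (fun θ => poissonWeight x θ * u θ) (π : Measure ℝ≥0) := by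
  refine Integrable.of_bound ((measurable_poissonWeight x).mul hu).aestronglyMeasurable M ?_
  filter_upwards [hM] with θ h
  rw [Real.norm_eq_abs, abs_mul, abs_of_nonneg (poissonWeight_nonneg x θ)]
  nlinarith [poissonWeight_le_one x θ, poissonWeight_nonneg x θ, abs_nonneg (u θ)]

lemma integrable_poissonWeight (x : ℕ) : Integrable (poissonWeight x) (π : Measure ℝ≥0) := by
  simpa using integrable_poissonWeight_mul π (u := fun _ => 1) measurable_const (M := 1) (by simp) x

lemma mixture_nonneg (x : ℕ) : 0 ≤ mixture π x :=
  integral_nonneg fun θ => poissonWeight_nonneg x θ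

lemma ofReal_mixture (x : ℕ) : ENNReal.ofReal (mixture π x) =
    ∫⁻ θ, ENNReal.ofReal (poissonWeight x θ) ∂(π : Measure ℝ≥0) :=
  ofReal_integral_eq_lintegral_ofReal (integrable_poissonWeight π x)
    (ae_of_all _ fun θ => poissonWeight_nonneg x θ)

lemma tsum_ofReal_mixture : ∑' x, ENNReal.ofReal (mixture π x) = 1 := by
  have h := lintegral_jointLaw π (G := fun _ => 1) measurable_const
  simp only [lintegral_const, measure_univ, mul_one] at h
  simp_rw [ofReal_mixture]
  exact h.symm

lemma abs_integral_poissonWeight_mul_le {u : ℝ≥0 → ℝ} (hu : Measurable u) {M : ℝ}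
    (hM : ∀ᵐ θ ∂(π : Measure ℝ≥0), |u θ| ≤ M) (x : ℕ) :
    |∫ θ, poissonWeight x θ * u θ ∂(π : Measure ℝ≥0)| ≤ M * mixture π x := by
  rw [mixture, ← integral_const_mul]
  refine (abs_integral_le_integral_abs).trans (integral_mono_ae
    (integrable_poissonWeight_mul π hu hM x).abs ((integrable_poissonWeight π x).const_mul M) ?_)
  filter_upwards [hM] with θ h
  simp only [abs_mul, abs_of_nonneg (poissonWeight_nonneg x θ)]
  nlinarith [poissonWeight_nonneg x θ]

/-- Where the mixture vanishes, boundedness of `u` makes the numerator vanish too, so the junk value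
of the division does no harm. -/
lemma posteriorMean_mul_mixture {u : ℝ≥0 → ℝ} (hu : Measurable u) {M : ℝ}
    (hM : ∀ᵐ θ ∂(π : Measure ℝ≥0), |u θ| ≤ M) (x : ℕ) :
    posteriorMean π u x * mixture π x = ∫ θ, poissonWeight x θ * u θ ∂(π : Measure ℝ≥0) := by
  rcases eq_or_ne (mixture π x) 0 with h0 | h0
  · have := abs_integral_poissonWeight_mul_le π hu hM x
    rw [h0, mul_zero] at this
    rw [h0, mul_zero, abs_nonpos_iff.1 this]
  · rw [posteriorMean, div_mul_cancel₀ _ h0]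

lemma abs_posteriorMean_le {u : ℝ≥0 → ℝ} (hu : Measurable u) {M : ℝ} (hM0 : 0 ≤ M)
    (hM : ∀ᵐ θ ∂(π : Measure ℝ≥0), |u θ| ≤ M) (x : ℕ) : |posteriorMean π u x| ≤ M := by
  rw [posteriorMean, abs_div, abs_of_nonneg (mixture_nonneg π x)]
  exact div_le_of_le_mul₀ (mixture_nonneg π x) hM0 (abs_integral_poissonWeight_mul_le π hu hM x)

lemma abs_posteriorMean_sub_le {u v : ℝ≥0 → ℝ} (hu : Measurable u) (hv : Measurable v) {M ε : ℝ}
    (hε0 : 0 ≤ ε) (hM : ∀ᵐ θ ∂(π : Measure ℝ≥0), |v θ| ≤ M)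
    (hε : ∀ᵐ θ ∂(π : Measure ℝ≥0), |u θ - v θ| ≤ ε) (x : ℕ) :
    |posteriorMean π u x - posteriorMean π v x| ≤ ε := by
  have hu' : ∀ᵐ θ ∂(π : Measure ℝ≥0), |u θ| ≤ M + ε := by
    filter_upwards [hM, hε] with θ h1 h2
    have := abs_add_le (v θ) (u θ - v θ)
    rw [add_sub_cancel] at this
    linarith
  have h : posteriorMean π u x - posteriorMean π v x = posteriorMean π (fun θ => u θ - v θ) x := by
    simp only [posteriorMean, mul_sub]
    rw [integral_sub (integrable_poissonWeight_mul π hu hu' x)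
      (integrable_poissonWeight_mul π hv hM x), sub_div]
  rw [h]
  exact abs_posteriorMean_le π (hu.sub hv) hε0 hε x

/-- The contribution of `X = x` to the squared error of the posterior mean. -/
noncomputable def posteriorRisk (u : ℝ≥0 → ℝ) (x : ℕ) : ℝ :=
  ∫ θ, poissonWeight x θ * (posteriorMean π u x - u θ) ^ 2 ∂(π : Measure ℝ≥0)

lemma posteriorRisk_nonneg (u : ℝ≥0 → ℝ) (x : ℕ) : 0 ≤ posteriorRisk π u x :=
  integral_nonneg fun θ => mul_nonneg (poissonWeight_nonneg x θ) (sq_nonneg _)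

/-- The bias-variance decomposition of the squared error given `X = x`. -/
lemma lintegral_poissonWeight_sq {u : ℝ≥0 → ℝ} (hu : Measurable u) {M : ℝ}
    (hM : ∀ᵐ θ ∂(π : Measure ℝ≥0), |u θ| ≤ M) (x : ℕ) (t : ℝ) :
    ∫⁻ θ, ENNReal.ofReal (poissonWeight x θ) * ENNReal.ofReal ((t - u θ) ^ 2) ∂(π : Measure ℝ≥0) =
      ENNReal.ofReal (posteriorRisk π u x) +
        ENNReal.ofReal (mixture π x * (t - posteriorMean π u x) ^ 2) := by
  have hint : ∀ s : ℝ, Integrable (fun θ => poissonWeight x θ * (s - u θ) ^ 2)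
      (π : Measure ℝ≥0) := by
    intro s
    refine integrable_poissonWeight_mul π (by fun_prop) (M := (|s| + M) ^ 2) ?_ x
    filter_upwards [hM] with θ h
    rw [abs_pow]
    exact pow_le_pow_left₀ (abs_nonneg _) ((abs_sub _ _).trans (by linarith)) 2
  have h1 : ∀ θ, ENNReal.ofReal (poissonWeight x θ) * ENNReal.ofReal ((t - u θ) ^ 2) =
      ENNReal.ofReal (poissonWeight x θ * (t - u θ) ^ 2) := fun θ =>
    (ENNReal.ofReal_mul (poissonWeight_nonneg x θ)).symm
  simp_rw [h1]
  rw [← ofReal_integral_eq_lintegral_ofReal (hint t)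
    (ae_of_all _ fun θ => mul_nonneg (poissonWeight_nonneg x θ) (sq_nonneg _)),
    ← ENNReal.ofReal_add (posteriorRisk_nonneg π u x)
      (mul_nonneg (mixture_nonneg π x) (sq_nonneg _))]
  congr 1
  set τ := posteriorMean π u x with hτ
  have h2 : ∀ θ, poissonWeight x θ * (t - u θ) ^ 2 = poissonWeight x θ * (τ - u θ) ^ 2 +
      (((t - τ) ^ 2 + 2 * (t - τ) * τ) * poissonWeight x θ
        - 2 * (t - τ) * (poissonWeight x θ * u θ)) := fun θ => by ring
  have i1 := integrable_poissonWeight π x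
  have i2 := integrable_poissonWeight_mul π hu hM x
  have i3 : Integrable (fun θ => ((t - τ) ^ 2 + 2 * (t - τ) * τ) * poissonWeight x θ
      - 2 * (t - τ) * (poissonWeight x θ * u θ)) (π : Measure ℝ≥0) :=
    (i1.const_mul _).sub (i2.const_mul _)
  simp_rw [h2]
  rw [integral_add (hint τ) i3,
    integral_sub (i1.const_mul _) (i2.const_mul _), integral_const_mul, integral_const_mul,
    ← posteriorMean_mul_mixture π hu hM x, ← hτ, posteriorRisk, ← hτ, mixture]
  ring

/-- The first sum does not involve `t` and is the Bayes risk; the second is the regret of `t`. -/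
lemma lintegral_jointLaw_sq {u : ℝ≥0 → ℝ} (hu : Measurable u) {M : ℝ}
    (hM : ∀ᵐ θ ∂(π : Measure ℝ≥0), |u θ| ≤ M) (t : ℕ → ℝ) :
    ∫⁻ z, ENNReal.ofReal ((t z.2 - u z.1) ^ 2) ∂(jointLaw π) =
      ∑' x, ENNReal.ofReal (posteriorRisk π u x) +
        ∑' x, ENNReal.ofReal (mixture π x * (t x - posteriorMean π u x) ^ 2) := by
  rw [lintegral_jointLaw π (by fun_prop), ← ENNReal.tsum_add]
  exact tsum_congr fun x => lintegral_poissonWeight_sq π hu hM x (t x)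

/-! ### Moments of the mixture -/

/-- Robbins' identity with `θ ^ m ≤ h ^ m`. It controls the variance of the numerator as well as the
tail of the mixture. -/
lemma ascFactorial_mul_mixture_add_le {h : ℝ}
    (hπ : ∀ᵐ θ : ℝ≥0 ∂(π : Measure ℝ≥0), (θ : ℝ) ≤ h) (x m : ℕ) :
    (x + 1).ascFactorial m * mixture π (x + m) ≤ h ^ m * mixture π x := by
  rw [mixture, mixture, ← integral_const_mul, ← integral_const_mul]
  refine integral_mono_ae ((integrable_poissonWeight π _).const_mul _)
    ((integrable_poissonWeight π _).const_mul _) ?_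
  filter_upwards [hπ] with θ hθ
  rw [poissonWeight_add]
  exact mul_le_mul_of_nonneg_right (pow_le_pow_left₀ θ.2 hθ m) (poissonWeight_nonneg x θ)

lemma integral_poissonWeight_mul_poly (b : ℕ → ℝ) (k x : ℕ) :
    ∫ θ : ℝ≥0, poissonWeight x θ * ∑ m ∈ Finset.range (k + 1), b m * (θ : ℝ) ^ m
      ∂(π : Measure ℝ≥0) =
    ∑ m ∈ Finset.range (k + 1), b m * (x + 1).ascFactorial m * mixture π (x + m) := by
  have : ∀ θ : ℝ≥0, poissonWeight x θ * ∑ m ∈ Finset.range (k + 1), b m * (θ : ℝ) ^ m =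
      ∑ m ∈ Finset.range (k + 1), b m * (x + 1).ascFactorial m * poissonWeight (x + m) θ := by
    intro θ
    rw [Finset.mul_sum]
    refine Finset.sum_congr rfl fun m _ => ?_
    rw [mul_assoc, poissonWeight_add]
    ring
  simp_rw [this]
  rw [integral_finsetSum _ fun m _ => (integrable_poissonWeight π _).const_mul _]
  simp_rw [integral_const_mul]
  rfl

/-- Since `(x+1)⋯(x+K+1) ≥ (K+1)!`, a shift by `K + 1` costs a factor `h ^ (K+1) / (K+1)!`; the
shifted masses are then summed against total mass one. -/
lemma tsum_tail_mixture_le {h : ℝ} (hh : 0 ≤ h) (hπ : ∀ᵐ θ : ℝ≥0 ∂(π : Measure ℝ≥0), (θ : ℝ) ≤ h)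
    (K : ℕ) : ∑' x, (if x ≤ K then 0 else ENNReal.ofReal (mixture π x)) ≤
      ENNReal.ofReal (h ^ (K + 1) / (K + 1).factorial) := by
  have h0 := Summable.sum_add_tsum_nat_add' (k := K + 1)
    (f := fun x => if x ≤ K then 0 else ENNReal.ofReal (mixture π x)) ENNReal.summable
  have h1 : ∀ x ∈ Finset.range (K + 1),
      (if x ≤ K then 0 else ENNReal.ofReal (mixture π x)) = 0 := fun x hx =>
    if_pos (Nat.lt_succ_iff.1 (Finset.mem_range.1 hx))
  rw [← h0, Finset.sum_eq_zero h1, zero_add]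
  calc _ ≤ ∑' x, ENNReal.ofReal (h ^ (K + 1) / (K + 1).factorial) *
          ENNReal.ofReal (mixture π x) := by
        refine ENNReal.tsum_le_tsum fun x => ?_
        rw [if_neg (by omega), ← ENNReal.ofReal_mul (by positivity)]
        refine ENNReal.ofReal_le_ofReal ?_
        have h1 := ascFactorial_mul_mixture_add_le π hπ x (K + 1)
        have h2 : ((K + 1).factorial : ℝ) ≤ (x + 1).ascFactorial (K + 1) := by
          rw [← Nat.one_ascFactorial]
          exact_mod_cast Nat.ascFactorial_le _ (by omega : 1 ≤ x + 1)
        rw [div_mul_eq_mul_div, le_div_iff₀ (by positivity)]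
        nlinarith [mixture_nonneg π (x + (K + 1))]
    _ = _ := by rw [ENNReal.tsum_mul_left, tsum_ofReal_mixture, mul_one]

lemma jointLaw_real_snd_eq (x : ℕ) : (jointLaw π).real {z | z.2 = x} = mixture π x := by
  have hms : MeasurableSet {z : ℝ≥0 × ℕ | z.2 = x} := measurable_snd (measurableSet_singleton x)
  rw [measureReal_def, ← ENNReal.toReal_ofReal (mixture_nonneg π x)]
  congr 1
  rw [← lintegral_indicator_one hms, lintegral_jointLaw π (measurable_one.indicator hms),
    tsum_eq_single x, ofReal_mixture]
  · refine lintegral_congr fun θ => ?_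
    simp [indicator]
  · intro y hy
    simp [indicator, hy]

lemma integral_jointLaw_ite (x : ℕ) :
    ∫ z, (if z.2 = x then 1 else 0 : ℝ) ∂(jointLaw π) = mixture π x := by
  have hms : MeasurableSet {z : ℝ≥0 × ℕ | z.2 = x} := measurable_snd (measurableSet_singleton x)
  rw [← jointLaw_real_snd_eq, ← integral_indicator_one hms]
  refine integral_congr_ae (ae_of_all _ fun z => ?_)
  simp [indicator]

lemma integrable_jointLaw_ite (x : ℕ) :
    Integrable (fun z : ℝ≥0 × ℕ => (if z.2 = x then 1 else 0 : ℝ)) (jointLaw π) := by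
  refine Integrable.of_bound (C := 1) ?_ (ae_of_all _ fun z => ?_)
  · exact (Measurable.ite (measurable_snd (measurableSet_singleton x))
      measurable_const measurable_const).aestronglyMeasurable
  · split_ifs <;> simp

end Mixture

/-! ### The Robbins-type estimator -/

/-- The empirical frequency of `x` in the sample `y`. -/
noncomputable def empiricalFreq {n : ℕ} (y : Fin n → ℕ) (x : ℕ) : ℝ :=
  (n : ℝ)⁻¹ * ∑ i, if y i = x then 1 else 0

/-- The empirical version of `x ↦ ∫ P(θ) Poi(x; θ) dπ(θ)` for `P = ∑ₘ bₘ θᵐ`. -/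
noncomputable def robbinsNumerator (b : ℕ → ℝ) (k : ℕ) {n : ℕ} (y : Fin n → ℕ) (x : ℕ) : ℝ :=
  ∑ m ∈ Finset.range (k + 1), b m * (x + 1).ascFactorial m * empiricalFreq y (x + m)

/-- Robbins' estimate of the posterior mean of `∑ₘ bₘ θᵐ`, clipped to `[-M, M]`. -/
noncomputable def robbinsEstimate (b : ℕ → ℝ) (k : ℕ) (M : ℝ) {n : ℕ} (y : Fin n → ℕ) (x : ℕ) : ℝ :=
  max (-M) (min M (robbinsNumerator b k y x / empiricalFreq y x))

lemma abs_clip_le {M : ℝ} (hM : 0 ≤ M) (a : ℝ) : |max (-M) (min M a)| ≤ M :=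
  abs_le.2 ⟨le_max_left _ _, max_le (by linarith) (min_le_left _ _)⟩

lemma abs_clip_sub_le {M t : ℝ} (ht : |t| ≤ M) (a : ℝ) : |max (-M) (min M a) - t| ≤ |a - t| := by
  obtain ⟨h1, h2⟩ := abs_le.1 ht
  rcases le_total a M with h | h
  · rw [min_eq_right h]
    rcases le_total (-M) a with h' | h'
    · rw [max_eq_right h']
    · rw [max_eq_left h', abs_of_nonpos (by linarith), abs_of_nonpos (by linarith)]
      linarith
  · rw [min_eq_left h, max_eq_right (by linarith), abs_of_nonneg (by linarith),
      abs_of_nonneg (by linarith)]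
    linarith

/-- With `D` the clipped error, write `f D = g D - (g - f) D`. Clipping towards `[-M, M]`, which
contains `t`, gives `|g D| ≤ |a - t g|`, also when `g = 0`, and `|D| ≤ 2 M`. No lower bound on the
denominator `g` is needed. -/
lemma sq_mul_clip_ratio_sub_le {f g a t M : ℝ} (ht : |t| ≤ M) :
    f ^ 2 * (max (-M) (min M (a / g)) - t) ^ 2 ≤
      2 * (a - t * g) ^ 2 + 8 * M ^ 2 * (g - f) ^ 2 := by
  have hM : 0 ≤ M := (abs_nonneg t).trans ht
  set D := max (-M) (min M (a / g)) - t with hD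
  have h1 : |g * D| ≤ |a - t * g| := by
    rcases eq_or_ne g 0 with rfl | hg
    · simp
    · rw [abs_mul]
      calc |g| * |D| ≤ |g| * |a / g - t| :=
            mul_le_mul_of_nonneg_left (abs_clip_sub_le ht _) (abs_nonneg _)
        _ = |a - t * g| := by rw [← abs_mul]; congr 1; field_simp
  have h2 : |D| ≤ 2 * M := by
    have := abs_sub (max (-M) (min M (a / g))) t
    have := abs_clip_le hM (a / g)
    linarith
  have h3 : (g * D) ^ 2 ≤ (a - t * g) ^ 2 := sq_le_sq.2 h1
  have h4 : D ^ 2 ≤ 4 * M ^ 2 := by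
    rw [← sq_abs]
    nlinarith [abs_nonneg D]
  have h5 : (g - f) ^ 2 * D ^ 2 ≤ (g - f) ^ 2 * (4 * M ^ 2) :=
    mul_le_mul_of_nonneg_left h4 (sq_nonneg _)
  nlinarith [sq_nonneg (g * D + (g - f) * D)]

/-! ### Mean squared errors of the empirical quantities -/

section Estimate

variable (π : ProbabilityMeasure ℝ≥0)

lemma lintegral_sq_mean_le {n : ℕ} (hn : 0 < n) {φ : ℝ≥0 × ℕ → ℝ} (hφ : Measurable φ) {C V : ℝ}
    (hC : ∀ z, |φ z| ≤ C) (h0 : ∫ z, φ z ∂(jointLaw π) = 0)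
    (hV : ∫ z, φ z ^ 2 ∂(jointLaw π) ≤ V) :
    ∫⁻ ω, ENNReal.ofReal (((n : ℝ)⁻¹ * ∑ i, φ (ω i)) ^ 2) ∂(sampleLaw π n) ≤
      ENNReal.ofReal (V / n) := by
  have hL : MemLp φ 2 (jointLaw π) :=
    MemLp.of_bound hφ.aestronglyMeasurable C (ae_of_all _ hC)
  have hvar := variance_sum_pi (ι := Fin n) (μ := fun _ => jointLaw π) (X := fun _ => φ)
    fun _ => hL
  have hLi : ∀ i : Fin n, MemLp (fun ω : Fin n → ℝ≥0 × ℕ => φ (ω i)) 2 (sampleLaw π n) :=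
    fun i => hL.comp_measurePreserving (measurePreserving_eval (fun _ => jointLaw π) i)
  have hLs : MemLp (fun ω : Fin n → ℝ≥0 × ℕ => ∑ i, φ (ω i)) 2 (sampleLaw π n) :=
    memLp_finsetSum _ fun i _ => hLi i
  have hmean : ∫ ω, ∑ i, φ (ω i) ∂(sampleLaw π n) = 0 := by
    rw [integral_finsetSum _ fun i _ => (hLi i).integrable (by norm_num)]
    refine Finset.sum_eq_zero fun i _ => ?_
    have hi := measurePreserving_eval (fun _ : Fin n => jointLaw π) i
    rw [← h0, ← hi.map_eq, integral_map hi.aemeasurable hφ.aestronglyMeasurable]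
    rfl
  have hsq : ∫ ω, (∑ i, φ (ω i)) ^ 2 ∂(sampleLaw π n) = n * ∫ z, φ z ^ 2 ∂(jointLaw π) := by
    rw [← variance_of_integral_eq_zero hLs.aestronglyMeasurable.aemeasurable hmean,
      ← variance_of_integral_eq_zero hφ.aemeasurable h0]
    have e : (fun ω : Fin n → ℝ≥0 × ℕ => ∑ i, φ (ω i)) = ∑ i, fun ω => φ (ω i) := by
      ext ω; simp
    rw [e, sampleLaw, hvar]
    simp
  have hn' : (0 : ℝ) < n := by exact_mod_cast hn
  simp_rw [mul_pow]
  rw [← ofReal_integral_eq_lintegral_ofReal (hLs.integrable_sq.const_mul _)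
    (ae_of_all _ fun ω => by positivity), integral_const_mul, hsq]
  refine ENNReal.ofReal_le_ofReal ?_
  rw [show ((n : ℝ)⁻¹) ^ 2 * (n * ∫ z, φ z ^ 2 ∂(jointLaw π)) =
    (∫ z, φ z ^ 2 ∂(jointLaw π)) / n by field_simp]
  exact div_le_div_of_nonneg_right hV hn'.le

lemma measurable_ite_snd_eq (x : ℕ) :
    Measurable (fun z : ℝ≥0 × ℕ => (if z.2 = x then 1 else 0 : ℝ)) :=
  Measurable.ite (measurable_snd (measurableSet_singleton x)) measurable_const measurable_const

lemma lintegral_sq_empiricalFreq_sub_le {n : ℕ} (hn : 0 < n) (x : ℕ) :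
    ∫⁻ ω, ENNReal.ofReal ((empiricalFreq (fun i => (ω i).2) x - mixture π x) ^ 2)
      ∂(sampleLaw π n) ≤ ENNReal.ofReal (mixture π x / n) := by
  have hi := integrable_jointLaw_ite π x
  have hf0 := mixture_nonneg π x
  have key := lintegral_sq_mean_le π hn
    (φ := fun z => (if z.2 = x then 1 else 0 : ℝ) - mixture π x) (C := 1 + mixture π x)
    (V := mixture π x) ((measurable_ite_snd_eq x).sub measurable_const) ?_ ?_ ?_
  · refine le_trans (le_of_eq (lintegral_congr fun ω => ?_)) key
    congr 2
    have hn' : (n : ℝ) ≠ 0 := by positivity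
    rw [Finset.sum_sub_distrib, empiricalFreq, mul_sub]
    simp
    field_simp
  · intro z
    refine (abs_sub _ _).trans ?_
    rw [abs_of_nonneg hf0]
    split_ifs <;> simp
  · rw [integral_sub hi (integrable_const _), integral_jointLaw_ite]
    simp
  -- An indicator equals its square, so the variance is `f - f²`, which is at most `f`.
  · have e : ∀ z : ℝ≥0 × ℕ, ((if z.2 = x then 1 else 0 : ℝ) - mixture π x) ^ 2 =
        (1 - 2 * mixture π x) * (if z.2 = x then 1 else 0 : ℝ) + mixture π x ^ 2 := by
      intro z; split_ifs <;> ring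
    simp_rw [e]
    rw [integral_add (hi.const_mul _) (integrable_const _), integral_const_mul,
      integral_jointLaw_ite]
    simp
    nlinarith

/-- The events `y = x + m` are disjoint, so all cross terms vanish and the variance of the numerator
involves only the squares of the coefficients. -/
lemma sq_sum_ite_add (c : ℕ → ℝ) (k x y : ℕ) :
    (∑ m ∈ Finset.range (k + 1), c m * (if y = x + m then 1 else 0 : ℝ)) ^ 2 =
      ∑ m ∈ Finset.range (k + 1), c m ^ 2 * (if y = x + m then 1 else 0 : ℝ) := by
  have e : ∀ d : ℕ → ℝ, ∑ m ∈ Finset.range (k + 1), d m * (if y = x + m then 1 else 0 : ℝ) =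
      if x ≤ y ∧ y - x < k + 1 then d (y - x) else 0 := by
    intro d
    split_ifs with h
    · rw [Finset.sum_eq_single_of_mem (y - x) (Finset.mem_range.2 h.2)]
      · rw [if_pos (by omega), mul_one]
      · intro m _ hm
        rw [if_neg (by omega), mul_zero]
    · refine Finset.sum_eq_zero fun m hm => ?_
      rw [if_neg, mul_zero]
      rintro rfl
      exact h ⟨by omega, by simpa using hm⟩
  rw [e, e]
  split_ifs <;> simp

/-- The size of the variance of the Robbins numerator. -/
noncomputable def varianceProxy (b : ℕ → ℝ) (k : ℕ) (h : ℝ) (K : ℕ) : ℝ :=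
  ∑ m ∈ Finset.range (k + 1), b m ^ 2 * h ^ m * (K + 1).ascFactorial m

lemma varianceProxy_nonneg (b : ℕ → ℝ) (k : ℕ) {h : ℝ} (hh : 0 ≤ h) (K : ℕ) :
    0 ≤ varianceProxy b k h K :=
  Finset.sum_nonneg fun m _ => by positivity

/-- The hypothesis `htf` says that the statistic is centred. Its variance contains the square of
`(x+1)⋯(x+m)` times `f(x+m)`: one factor is absorbed by `ascFactorial_mul_mixture_add_le`, the other
is bounded by its value at `x = K`. The bound is thereby proportional to `f(x)`, as needed for the
later division by `f(x)`. -/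
lemma lintegral_sq_robbinsNumerator_sub_le {n : ℕ} (hn : 0 < n) (b : ℕ → ℝ) (k : ℕ) {h : ℝ}
    (hπ : ∀ᵐ θ : ℝ≥0 ∂(π : Measure ℝ≥0), (θ : ℝ) ≤ h) {x K : ℕ} (hx : x ≤ K)
    {t M : ℝ} (ht : |t| ≤ M) (htf : t * mixture π x =
      ∑ m ∈ Finset.range (k + 1), b m * (x + 1).ascFactorial m * mixture π (x + m)) :
    ∫⁻ ω, ENNReal.ofReal ((robbinsNumerator b k (fun i => (ω i).2) x -
        t * empiricalFreq (fun i => (ω i).2) x) ^ 2) ∂(sampleLaw π n) ≤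
      ENNReal.ofReal ((2 * M ^ 2 + 2 * varianceProxy b k h K) * mixture π x / n) := by
  set c : ℕ → ℝ := fun m => b m * (x + 1).ascFactorial m with hc
  have hf0 := mixture_nonneg π x
  have hi := integrable_jointLaw_ite π
  have key := lintegral_sq_mean_le π hn
    (φ := fun z => ∑ m ∈ Finset.range (k + 1), c m * (if z.2 = x + m then 1 else 0 : ℝ) -
      t * (if z.2 = x then 1 else 0 : ℝ)) (C := ∑ m ∈ Finset.range (k + 1), |c m| + M)
    (V := (2 * M ^ 2 + 2 * varianceProxy b k h K) * mixture π x) ?_ ?_ ?_ ?_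
  · refine le_trans (le_of_eq (lintegral_congr fun ω => ?_)) key
    congr 2
    have e1 : ∑ i, ∑ m ∈ Finset.range (k + 1), c m * (if (ω i).2 = x + m then 1 else 0 : ℝ) =
        ∑ m ∈ Finset.range (k + 1), c m * ∑ i, (if (ω i).2 = x + m then 1 else 0 : ℝ) := by
      rw [Finset.sum_comm]
      simp_rw [Finset.mul_sum]
    have e2 : robbinsNumerator b k (fun i => (ω i).2) x = (n : ℝ)⁻¹ *
        ∑ m ∈ Finset.range (k + 1), c m * ∑ i, (if (ω i).2 = x + m then 1 else 0 : ℝ) := by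
      rw [robbinsNumerator, Finset.mul_sum]
      exact Finset.sum_congr rfl fun m _ => by rw [empiricalFreq]; ring
    rw [e2, empiricalFreq, Finset.sum_sub_distrib, e1, ← Finset.mul_sum]
    ring
  · refine Measurable.sub (Finset.measurable_sum _ fun m _ => ?_) ?_
    · exact (measurable_ite_snd_eq _).const_mul _
    · exact (measurable_ite_snd_eq _).const_mul _
  · intro z
    refine (abs_sub _ _).trans (add_le_add ?_ ?_)
    · refine (Finset.abs_sum_le_sum_abs _ _).trans (Finset.sum_le_sum fun m _ => ?_)
      split_ifs <;> simp
    · refine le_trans ?_ ht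
      split_ifs <;> simp
  · rw [integral_sub (integrable_finsetSum _ fun m _ => (hi _).const_mul _) ((hi _).const_mul _),
      integral_finsetSum _ fun m _ => (hi _).const_mul _]
    simp_rw [integral_const_mul, integral_jointLaw_ite]
    rw [htf, sub_self]
  · have hbd : ∀ z : ℝ≥0 × ℕ,
        (∑ m ∈ Finset.range (k + 1), c m * (if z.2 = x + m then 1 else 0 : ℝ) -
          t * (if z.2 = x then 1 else 0 : ℝ)) ^ 2 ≤
        ∑ m ∈ Finset.range (k + 1), 2 * c m ^ 2 * (if z.2 = x + m then 1 else 0 : ℝ) +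
          2 * t ^ 2 * (if z.2 = x then 1 else 0 : ℝ) := by
      intro z
      have e1 := sq_sum_ite_add c k x z.2
      have e2 : (t * (if z.2 = x then 1 else 0 : ℝ)) ^ 2 =
          t ^ 2 * (if z.2 = x then 1 else 0 : ℝ) := by split_ifs <;> ring
      have e3 : ∑ m ∈ Finset.range (k + 1), 2 * c m ^ 2 * (if z.2 = x + m then 1 else 0 : ℝ) =
          2 * ∑ m ∈ Finset.range (k + 1), c m ^ 2 * (if z.2 = x + m then 1 else 0 : ℝ) := by
        rw [Finset.mul_sum]
        exact Finset.sum_congr rfl fun m _ => mul_assoc _ _ _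
      rw [e3, ← e1, mul_assoc, ← e2]
      nlinarith [sq_nonneg (∑ m ∈ Finset.range (k + 1), c m * (if z.2 = x + m then 1 else 0 : ℝ) +
        t * (if z.2 = x then 1 else 0 : ℝ))]
    have i1 : Integrable (fun z : ℝ≥0 × ℕ => ∑ m ∈ Finset.range (k + 1),
        2 * c m ^ 2 * (if z.2 = x + m then 1 else 0 : ℝ)) (jointLaw π) :=
      integrable_finsetSum _ fun m _ => (hi _).const_mul _
    have i2 : Integrable (fun z : ℝ≥0 × ℕ => 2 * t ^ 2 * (if z.2 = x then 1 else 0 : ℝ))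
        (jointLaw π) := (hi _).const_mul _
    refine (integral_mono_of_nonneg (ae_of_all _ fun z => sq_nonneg _) (i1.add i2)
      (ae_of_all _ hbd)).trans ?_
    simp only [Pi.add_apply]
    rw [integral_add i1 i2, integral_finsetSum _ fun m _ => (hi _).const_mul _]
    simp_rw [integral_const_mul, integral_jointLaw_ite]
    have h1 : ∑ m ∈ Finset.range (k + 1), 2 * c m ^ 2 * mixture π (x + m) ≤
        2 * varianceProxy b k h K * mixture π x := by
      rw [varianceProxy, Finset.mul_sum, Finset.sum_mul]
      refine Finset.sum_le_sum fun m _ => ?_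
      have g1 := ascFactorial_mul_mixture_add_le π hπ x m
      have g2 : ((x + 1).ascFactorial m : ℝ) ≤ (K + 1).ascFactorial m := by
        exact_mod_cast Nat.ascFactorial_le m (by omega : x + 1 ≤ K + 1)
      calc 2 * c m ^ 2 * mixture π (x + m)
          = 2 * b m ^ 2 * (x + 1).ascFactorial m *
            ((x + 1).ascFactorial m * mixture π (x + m)) := by rw [hc]; ring
        _ ≤ 2 * b m ^ 2 * (K + 1).ascFactorial m * (h ^ m * mixture π x) := by
            refine mul_le_mul ?_ g1 ?_ (by positivity)
            · exact mul_le_mul_of_nonneg_left g2 (by positivity)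
            · exact mul_nonneg (by positivity) (mixture_nonneg π _)
        _ = _ := by ring
    have h2 : t ^ 2 ≤ M ^ 2 := by
      rw [← sq_abs t]; exact pow_le_pow_left₀ (abs_nonneg _) ht 2
    nlinarith

/-- The expected loss of the Robbins estimate at `X = x`. -/
lemma lintegral_robbinsEstimate_le {n : ℕ} (hn : 0 < n) {u : ℝ≥0 → ℝ} (hu : Measurable u)
    (b : ℕ → ℝ) (k : ℕ) {h M ε : ℝ} (hh : 0 ≤ h) (hM0 : 0 ≤ M) (hε0 : 0 ≤ ε)
    (hπ : ∀ᵐ θ : ℝ≥0 ∂(π : Measure ℝ≥0), (θ : ℝ) ≤ h)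
    (hM : ∀ᵐ θ : ℝ≥0 ∂(π : Measure ℝ≥0), |∑ m ∈ Finset.range (k + 1), b m * (θ : ℝ) ^ m| ≤ M)
    (hε : ∀ᵐ θ : ℝ≥0 ∂(π : Measure ℝ≥0),
      |u θ - ∑ m ∈ Finset.range (k + 1), b m * (θ : ℝ) ^ m| ≤ ε) {x K : ℕ} (hx : x ≤ K) :
    ∫⁻ ω, ENNReal.ofReal (mixture π x *
      (robbinsEstimate b k M (fun i => (ω i).2) x - posteriorMean π u x) ^ 2) ∂(sampleLaw π n) ≤
      ENNReal.ofReal (2 * ε ^ 2 * mixture π x) +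
        ENNReal.ofReal ((24 * M ^ 2 + 8 * varianceProxy b k h K) / n) := by
  set f := mixture π x with hf
  have hf0 : 0 ≤ f := mixture_nonneg π x
  rcases hf0.eq_or_lt with hf0' | hf0'
  · rw [← hf0']; simp
  set v : ℝ≥0 → ℝ := fun θ => ∑ m ∈ Finset.range (k + 1), b m * (θ : ℝ) ^ m with hv
  have hvm : Measurable v := by fun_prop
  set t := posteriorMean π v x with ht
  have htM : |t| ≤ M := abs_posteriorMean_le π hvm hM0 hM x
  have htf : t * f =
      ∑ m ∈ Finset.range (k + 1), b m * (x + 1).ascFactorial m * mixture π (x + m) := by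
    rw [ht, hf, posteriorMean_mul_mixture π hvm hM x, hv, integral_poissonWeight_mul_poly]
  have hd : |posteriorMean π u x - t| ≤ ε := abs_posteriorMean_sub_le π hu hvm hε0 hM hε x
  have hn' : (0 : ℝ) < n := by exact_mod_cast hn
  have hS := varianceProxy_nonneg b k hh K
  -- The ratio inequality divided by `f`. Both squared deviations have mean of order `f / n`, so the
  -- factors `1 / f` cancel upon integration.
  have hpt : ∀ ω : Fin n → ℝ≥0 × ℕ, ENNReal.ofReal (f *
      (robbinsEstimate b k M (fun i => (ω i).2) x - posteriorMean π u x) ^ 2) ≤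
      ENNReal.ofReal (2 * ε ^ 2 * f) + (ENNReal.ofReal (4 / f) *
        ENNReal.ofReal ((robbinsNumerator b k (fun i => (ω i).2) x -
        t * empiricalFreq (fun i => (ω i).2) x) ^ 2) + ENNReal.ofReal (16 * M ^ 2 / f) *
        ENNReal.ofReal ((empiricalFreq (fun i => (ω i).2) x - f) ^ 2)) := by
    intro ω
    have h1 := sq_mul_clip_ratio_sub_le (f := f) (g := empiricalFreq (fun i => (ω i).2) x)
      (a := robbinsNumerator b k (fun i => (ω i).2) x) htM
    rw [← ENNReal.ofReal_mul (by positivity), ← ENNReal.ofReal_mul (by positivity),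
      ← ENNReal.ofReal_add (by positivity) (by positivity),
      ← ENNReal.ofReal_add (by positivity) (by positivity)]
    refine ENNReal.ofReal_le_ofReal ?_
    rw [robbinsEstimate]
    set T := max (-M) (min M (robbinsNumerator b k (fun i => (ω i).2) x /
      empiricalFreq (fun i => (ω i).2) x))
    set Z := (robbinsNumerator b k (fun i => (ω i).2) x -
        t * empiricalFreq (fun i => (ω i).2) x) ^ 2
    set W := (empiricalFreq (fun i => (ω i).2) x - f) ^ 2
    have h2 : (T - posteriorMean π u x) ^ 2 ≤ 2 * (T - t) ^ 2 + 2 * ε ^ 2 := by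
      have : (posteriorMean π u x - t) ^ 2 ≤ ε ^ 2 := by
        rw [← sq_abs]; exact pow_le_pow_left₀ (abs_nonneg _) hd 2
      nlinarith [sq_nonneg (T - t + (posteriorMean π u x - t))]
    have h3 : f * (T - t) ^ 2 ≤ (2 * Z + 8 * M ^ 2 * W) / f := by
      rw [le_div_iff₀ hf0']
      nlinarith
    have h4 : 4 / f * Z + 16 * M ^ 2 / f * W = 2 * ((2 * Z + 8 * M ^ 2 * W) / f) := by
      field_simp; ring
    rw [h4]
    nlinarith
  have hmeas : ∀ g : (Fin n → ℕ) → ℝ, Measurable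
      (fun ω : Fin n → ℝ≥0 × ℕ => ENNReal.ofReal (g fun i => (ω i).2)) := by
    intro g
    have h1 : Measurable (fun ω : Fin n → ℝ≥0 × ℕ => fun i => (ω i).2) := by fun_prop
    exact ((measurable_of_countable g).comp h1).ennreal_ofReal
  have m1 := hmeas fun y => (robbinsNumerator b k y x - t * empiricalFreq y x) ^ 2
  have m2 := hmeas fun y => (empiricalFreq y x - f) ^ 2
  refine (lintegral_mono hpt).trans ?_
  rw [lintegral_add_left measurable_const, lintegral_const, measure_univ, mul_one,
    lintegral_add_left (m1.const_mul _), lintegral_const_mul _ m1, lintegral_const_mul _ m2]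
  refine add_le_add le_rfl ?_
  refine (add_le_add (mul_le_mul_right
    (lintegral_sq_robbinsNumerator_sub_le π hn b k hπ hx htM htf) _)
    (mul_le_mul_right (lintegral_sq_empiricalFreq_sub_le π hn x) _)).trans ?_
  rw [← ENNReal.ofReal_mul (by positivity), ← ENNReal.ofReal_mul (by positivity),
    ← ENNReal.ofReal_add (by positivity) (by positivity)]
  refine ENNReal.ofReal_le_ofReal (le_of_eq ?_)
  rw [← hf]
  field_simp
  ring

end Estimate

/-! ### The total regret of the Robbins-type estimator -/

section Risk

variable (π : ProbabilityMeasure ℝ≥0)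

lemma ae_jointLaw_fst {p : ℝ≥0 → Prop} (hp : ∀ᵐ θ ∂(π : Measure ℝ≥0), p θ) :
    ∀ᵐ z ∂(jointLaw π), p z.1 := by
  refine ae_of_ae_map (f := Prod.fst) measurable_fst.aemeasurable ?_
  have : (jointLaw π).map Prod.fst = (π : Measure ℝ≥0) :=
    Measure.fst_compProd (π : Measure ℝ≥0) poissonKernel
  rwa [this]

/-- Dropping the nonnegative regret term bounds the risk of every `t` from below. Only this
direction is needed for an upper bound on the regret. -/
lemma tsum_posteriorRisk_le_mmse {ℓ : ℝ → ℝ} {u : ℝ≥0 → ℝ} (hu : Measurable u) {M : ℝ}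
    (hM : ∀ᵐ θ ∂(π : Measure ℝ≥0), |u θ| ≤ M) (hℓ : ∀ᵐ θ : ℝ≥0 ∂(π : Measure ℝ≥0), ℓ θ = u θ) :
    ∑' x, ENNReal.ofReal (posteriorRisk π u x) ≤ mmse π ℓ := by
  have hae := ae_jointLaw_fst π hℓ
  refine le_iInf fun t => ?_
  have e : ∫⁻ z, ENNReal.ofReal ((t z.2 - ℓ z.1) ^ 2) ∂(jointLaw π) =
      ∫⁻ z, ENNReal.ofReal ((t z.2 - u z.1) ^ 2) ∂(jointLaw π) :=
    lintegral_congr_ae (hae.mono fun z hz => by simp only [hz])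
  rw [e, lintegral_jointLaw_sq π hu hM]
  exact le_self_add

lemma measurable_sample {n : ℕ} (g : (Fin n → ℕ) → ℝ) :
    Measurable (fun ω : Fin n → ℝ≥0 × ℕ => g fun i => (ω i).2) := by
  have h1 : Measurable (fun ω : Fin n → ℝ≥0 × ℕ => fun i => (ω i).2) := by fun_prop
  exact (measurable_of_countable g).comp h1

/-- The risk, at a single coordinate, of an estimator built from the other observations. -/
lemma lintegral_coordinate_eq {n : ℕ} {u : ℝ≥0 → ℝ} (hu : Measurable u) {M : ℝ}
    (hM : ∀ᵐ θ ∂(π : Measure ℝ≥0), |u θ| ≤ M) (τ : (Fin n → ℕ) → ℕ → ℝ) (j : Fin (n + 1)) :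
    ∫⁻ ω, ENNReal.ofReal ((τ (fun i => (ω (j.succAbove i)).2) (ω j).2 - u (ω j).1) ^ 2)
      ∂(sampleLaw π (n + 1)) =
    ∑' x, ENNReal.ofReal (posteriorRisk π u x) +
      ∑' x, ∫⁻ ω, ENNReal.ofReal (mixture π x *
        (τ (fun i => (ω i).2) x - posteriorMean π u x) ^ 2) ∂(sampleLaw π n) := by
  -- Coordinate `j` is split off as an independent factor; with the other observations frozen, the
  -- rule is a fixed function of `Xⱼ` and the one-observation decomposition applies.
  have hmp := measurePreserving_piFinSuccAbove (fun _ : Fin (n + 1) => jointLaw π) j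
  set G : (ℝ≥0 × ℕ) × (Fin n → ℝ≥0 × ℕ) → ℝ≥0∞ := fun p =>
    ENNReal.ofReal ((τ (fun i => (p.2 i).2) p.1.2 - u p.1.1) ^ 2) with hG
  have hGm : Measurable G := by
    have h1 : Measurable (fun p : (ℝ≥0 × ℕ) × (Fin n → ℝ≥0 × ℕ) =>
        ((fun i => (p.2 i).2, p.1.2) : (Fin n → ℕ) × ℕ)) := by fun_prop
    have h2 : Measurable (fun q : (Fin n → ℕ) × ℕ => τ q.1 q.2) := measurable_of_countable _
    have h3 := h2.comp h1
    have h4 : Measurable (fun p : (ℝ≥0 × ℕ) × (Fin n → ℝ≥0 × ℕ) => u p.1.1) := by fun_prop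
    exact ((h3.sub h4).pow_const 2).ennreal_ofReal
  have e1 := hmp.lintegral_comp hGm
  have e2 : ∫⁻ ω, ENNReal.ofReal ((τ (fun i => (ω (j.succAbove i)).2) (ω j).2 - u (ω j).1) ^ 2)
      ∂(sampleLaw π (n + 1)) = ∫⁻ p, G p ∂((jointLaw π).prod (sampleLaw π n)) := e1
  rw [e2, lintegral_prod_symm _ hGm.aemeasurable]
  have e3 : ∀ y : Fin n → ℝ≥0 × ℕ, ∫⁻ z, G (z, y) ∂(jointLaw π) =
      ∑' x, ENNReal.ofReal (posteriorRisk π u x) +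
        ∑' x, ENNReal.ofReal (mixture π x *
          (τ (fun i => (y i).2) x - posteriorMean π u x) ^ 2) := fun y =>
    lintegral_jointLaw_sq π hu hM (τ fun i => (y i).2)
  simp_rw [e3]
  rw [lintegral_add_left measurable_const, lintegral_const, measure_univ, mul_one,
    lintegral_tsum fun x => ?_]
  exact (measurable_sample fun y => mixture π x *
    (τ y x - posteriorMean π u x) ^ 2).ennreal_ofReal.aemeasurable

/-- Each of the `K + 1` values `x ≤ K` contributes a variance of order `1 / n`. For larger `x` the
estimate is useless, but clipping keeps its error bounded and the mixture has little mass there. -/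
lemma tsum_robbinsEstimate_le {n : ℕ} (hn : 0 < n) {u : ℝ≥0 → ℝ} (hu : Measurable u)
    (b : ℕ → ℝ) (k : ℕ) {h M ε : ℝ} (hh : 0 ≤ h) (hM0 : 0 ≤ M) (hε0 : 0 ≤ ε)
    (hπ : ∀ᵐ θ : ℝ≥0 ∂(π : Measure ℝ≥0), (θ : ℝ) ≤ h)
    (hM : ∀ᵐ θ : ℝ≥0 ∂(π : Measure ℝ≥0), |∑ m ∈ Finset.range (k + 1), b m * (θ : ℝ) ^ m| ≤ M)
    (hε : ∀ᵐ θ : ℝ≥0 ∂(π : Measure ℝ≥0),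
      |u θ - ∑ m ∈ Finset.range (k + 1), b m * (θ : ℝ) ^ m| ≤ ε) (K : ℕ) :
    ∑' x, ∫⁻ ω, ENNReal.ofReal (mixture π x *
      (robbinsEstimate b k M (fun i => (ω i).2) x - posteriorMean π u x) ^ 2) ∂(sampleLaw π n) ≤
      ENNReal.ofReal (2 * ε ^ 2 + (K + 1) * ((24 * M ^ 2 + 8 * varianceProxy b k h K) / n) +
        8 * M ^ 2 * (h ^ (K + 1) / (K + 1).factorial)) := by
  have hS := varianceProxy_nonneg b k hh K
  set V := (24 * M ^ 2 + 8 * varianceProxy b k h K) / n with hV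
  have hV0 : 0 ≤ V := by positivity
  have hvm : Measurable (fun θ : ℝ≥0 => ∑ m ∈ Finset.range (k + 1), b m * (θ : ℝ) ^ m) := by
    fun_prop
  have hx : ∀ x, ∫⁻ ω, ENNReal.ofReal (mixture π x *
      (robbinsEstimate b k M (fun i => (ω i).2) x - posteriorMean π u x) ^ 2) ∂(sampleLaw π n) ≤
      ENNReal.ofReal (2 * ε ^ 2) * ENNReal.ofReal (mixture π x) +
        ((if x ∈ Finset.range (K + 1) then ENNReal.ofReal V else 0) +
        ENNReal.ofReal (8 * M ^ 2) * (if x ≤ K then 0 else ENNReal.ofReal (mixture π x))) := by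
    intro x
    have hf0 := mixture_nonneg π x
    rw [← ENNReal.ofReal_mul (by positivity)]
    by_cases hxK : x ≤ K
    · rw [if_pos (Finset.mem_range.2 (by omega)), if_pos hxK, mul_zero, add_zero]
      exact lintegral_robbinsEstimate_le π hn hu b k hh hM0 hε0 hπ hM hε hxK
    · rw [if_neg (by simpa using hxK), if_neg hxK, zero_add, ← ENNReal.ofReal_mul (by positivity),
        ← ENNReal.ofReal_add (by positivity) (by positivity)]
      refine (lintegral_mono fun ω => ENNReal.ofReal_le_ofReal
        (?_ : _ ≤ 2 * ε ^ 2 * mixture π x + 8 * M ^ 2 * mixture π x)).trans ?_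
      · have h1 := abs_posteriorMean_sub_le π hu hvm hε0 hM hε x
        have h2 := abs_posteriorMean_le π hvm hM0 hM x
        set t := posteriorMean π (fun θ : ℝ≥0 => ∑ m ∈ Finset.range (k + 1), b m * (θ : ℝ) ^ m) x
        set T := robbinsEstimate b k M (fun i => (ω i).2) x with hT
        have h3 : |T - t| ≤ 2 * M := by
          have h4 : |T| ≤ M := abs_clip_le hM0 _
          linarith [abs_sub T t]
        have h5 : (T - t) ^ 2 ≤ (2 * M) ^ 2 := by
          rw [← sq_abs]; exact pow_le_pow_left₀ (abs_nonneg _) h3 2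
        have h6 : (posteriorMean π u x - t) ^ 2 ≤ ε ^ 2 := by
          rw [← sq_abs]; exact pow_le_pow_left₀ (abs_nonneg _) h1 2
        have h7 : (T - posteriorMean π u x) ^ 2 ≤ 2 * ε ^ 2 + 8 * M ^ 2 := by
          nlinarith [sq_nonneg (T - t + (posteriorMean π u x - t))]
        nlinarith
      · rw [lintegral_const, measure_univ, mul_one]
  refine (ENNReal.tsum_le_tsum hx).trans ?_
  rw [ENNReal.tsum_add, ENNReal.tsum_add, ENNReal.tsum_mul_left, ENNReal.tsum_mul_left,
    tsum_ofReal_mixture, mul_one, ENNReal.ofReal_add (by positivity) (by positivity),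
    ENNReal.ofReal_add (by positivity) (by positivity), add_assoc]
  refine add_le_add le_rfl (add_le_add (le_of_eq ?_) ?_)
  · rw [tsum_eq_sum (s := Finset.range (K + 1)) fun x hx => if_neg hx,
      Finset.sum_congr rfl fun x hx => if_pos hx, Finset.sum_const, Finset.card_range,
      nsmul_eq_mul, ENNReal.ofReal_mul (by positivity)]
    congr 1
    rw [← Nat.cast_add_one, ENNReal.ofReal_natCast]
  · rw [ENNReal.ofReal_mul (p := 8 * M ^ 2) (by positivity)]
    exact mul_le_mul_right (tsum_tail_mixture_le π hh hπ K) _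

end Risk

/-- The estimator which applies the Robbins estimate built from the other observations. -/
noncomputable def robbinsEstimator (b : ℕ → ℝ) (k : ℕ) (M : ℝ) (n : ℕ) : Estimator (n + 1) :=
  fun X j => robbinsEstimate b k M (fun i => X (j.succAbove i)) (X j)

lemma totRegret_le_of_totalRisk_le {π : ProbabilityMeasure ℝ≥0} {ℓ : ℝ → ℝ} {n : ℕ}
    {T : Estimator n} {B : ℝ} (hB : 0 ≤ B)
    (h : totalRisk π ℓ T ≤ n * mmse π ℓ + ENNReal.ofReal B) : totRegret π ℓ T ≤ (B : EReal) := by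
  rw [totRegret]
  refine EReal.sub_le_of_le_add' ?_
  have h1 : ((ENNReal.ofReal B : ℝ≥0∞) : EReal) = (B : EReal) := by
    rw [EReal.coe_ennreal_ofReal, max_eq_left hB]
  rw [← h1, ← EReal.coe_ennreal_add]
  exact EReal.coe_ennreal_le_coe_ennreal_iff.2 h

lemma ae_le_of_mem_boundedPriors {π : ProbabilityMeasure ℝ≥0} {h : ℝ} (hπ : π ∈ boundedPriors h) :
    ∀ᵐ θ : ℝ≥0 ∂(π : Measure ℝ≥0), (θ : ℝ) ≤ h := by
  have hm : MeasurableSet {θ : ℝ≥0 | (θ : ℝ) ≤ h} :=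
    measurableSet_le (by fun_prop) measurable_const
  exact (prob_compl_eq_zero_iff hm).2 hπ

/-- If `P = ∑_{m ≤ k} bₘ θᵐ` is bounded by `M` and within `ε` of `ℓ` on `[0, h]`, the Robbins-type
estimator for `P` has small total regret for `ℓ`, uniformly over the priors on `[0, h]`. -/
theorem maxTotRegret_robbinsEstimator_le {h : ℝ} (hh : 0 < h) {ℓ : ℝ → ℝ}
    (hℓ : ContinuousOn ℓ (Icc 0 h)) (b : ℕ → ℝ) (k : ℕ) {M ε : ℝ}
    (hM : ∀ θ ∈ Icc 0 h, |∑ m ∈ Finset.range (k + 1), b m * θ ^ m| ≤ M)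
    (hε : ∀ θ ∈ Icc 0 h, |ℓ θ - ∑ m ∈ Finset.range (k + 1), b m * θ ^ m| ≤ ε) (K : ℕ) {n : ℕ}
    (hn : 0 < n) :
    maxTotRegret (boundedPriors h) ℓ (robbinsEstimator b k M n) ≤
      (((n + 1) * (2 * ε ^ 2 + (K + 1) * ((24 * M ^ 2 + 8 * varianceProxy b k h K) / n) +
        8 * M ^ 2 * (h ^ (K + 1) / (K + 1).factorial)) : ℝ) : EReal) := by
  have h0 : (0 : ℝ) ∈ Icc 0 h := ⟨le_rfl, hh.le⟩
  have hM0 : 0 ≤ M := (abs_nonneg _).trans (hM 0 h0)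
  have hε0 : 0 ≤ ε := (abs_nonneg _).trans (hε 0 h0)
  have hS := varianceProxy_nonneg b k hh.le K
  refine iSup₂_le fun π hπ => totRegret_le_of_totalRisk_le (by positivity) ?_
  have hπ' := ae_le_of_mem_boundedPriors hπ
  -- Outside `[0, h]` the function `ℓ` is arbitrary, possibly not measurable; `u` is a continuous
  -- function agreeing with it almost surely.
  set u : ℝ≥0 → ℝ := fun θ => IccExtend hh.le (domRestrict (Icc 0 h) ℓ) θ with hu
  have huc : Continuous u :=
    (hℓ.domRestrict.Icc_extend' (h := hh.le)).comp NNReal.continuous_coe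
  have hum := huc.measurable
  have hue : ∀ θ : ℝ≥0, (θ : ℝ) ≤ h → ℓ θ = u θ := fun θ hθ =>
    (IccExtend_of_mem hh.le (domRestrict (Icc 0 h) ℓ) ⟨θ.2, hθ⟩).symm
  have hℓu : ∀ᵐ θ : ℝ≥0 ∂(π : Measure ℝ≥0), ℓ θ = u θ := hπ'.mono hue
  have hMae : ∀ᵐ θ : ℝ≥0 ∂(π : Measure ℝ≥0),
      |∑ m ∈ Finset.range (k + 1), b m * (θ : ℝ) ^ m| ≤ M := hπ'.mono fun θ hθ => hM θ ⟨θ.2, hθ⟩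
  have hεae : ∀ᵐ θ : ℝ≥0 ∂(π : Measure ℝ≥0),
      |u θ - ∑ m ∈ Finset.range (k + 1), b m * (θ : ℝ) ^ m| ≤ ε :=
    hπ'.mono fun θ hθ => hue θ hθ ▸ hε θ ⟨θ.2, hθ⟩
  have hub : ∀ᵐ θ : ℝ≥0 ∂(π : Measure ℝ≥0), |u θ| ≤ M + ε := by
    filter_upwards [hMae, hεae] with θ h1 h2
    have := abs_add_le (∑ m ∈ Finset.range (k + 1), b m * (θ : ℝ) ^ m)
      (u θ - ∑ m ∈ Finset.range (k + 1), b m * (θ : ℝ) ^ m)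
    rw [add_sub_cancel] at this
    linarith
  have hae : ∀ᵐ ω ∂(sampleLaw π (n + 1)), ∀ j, ℓ (ω j).1 = u (ω j).1 := by
    have hae1 := ae_jointLaw_fst π hℓu
    exact ae_all_iff.2 fun j => (measurePreserving_eval (fun _ : Fin (n + 1) => jointLaw π)
      j).quasiMeasurePreserving.ae hae1
  have e1 : totalRisk π ℓ (robbinsEstimator b k M n) = ∑ j : Fin (n + 1),
      ∫⁻ ω, ENNReal.ofReal ((robbinsEstimate b k M (fun i => (ω (j.succAbove i)).2) (ω j).2 -
        u (ω j).1) ^ 2) ∂(sampleLaw π (n + 1)) := by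
    rw [← lintegral_finsetSum]
    · refine lintegral_congr_ae (hae.mono fun ω hω => ?_)
      simp only [hω]
      exact ENNReal.ofReal_sum_of_nonneg fun j _ => sq_nonneg _
    · intro j _
      have h1 := measurable_sample (n := n + 1)
        fun y => robbinsEstimate b k M (fun i => y (j.succAbove i)) (y j)
      have h2 : Measurable (fun ω : Fin (n + 1) → ℝ≥0 × ℕ => u (ω j).1) := by fun_prop
      exact ((h1.sub h2).pow_const 2).ennreal_ofReal
  rw [e1]
  calc _ ≤ ∑ j : Fin (n + 1), (mmse π ℓ + ENNReal.ofReal (2 * ε ^ 2 + (K + 1) *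
          ((24 * M ^ 2 + 8 * varianceProxy b k h K) / n) +
          8 * M ^ 2 * (h ^ (K + 1) / (K + 1).factorial))) := by
        refine Finset.sum_le_sum fun j _ => ?_
        rw [lintegral_coordinate_eq π hum hub (robbinsEstimate b k M) j]
        exact add_le_add (tsum_posteriorRisk_le_mmse π hum hub hℓu)
          (tsum_robbinsEstimate_le π hn hum b k hh.le hM0 hε0 hπ' hMae hεae K)
    _ = _ := by
        rw [Finset.sum_const, Finset.card_univ, Fintype.card_fin, nsmul_eq_mul, mul_add,
          ENNReal.ofReal_mul (by positivity)]
        congr 2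
        rw [← Nat.cast_add_one, ENNReal.ofReal_natCast]

/-! ### Operations on regret bounds -/

lemma RegretBound.of_maxTotRegret_le {h : ℝ} {ℓ : ℝ → ℝ} {n : ℕ} {B : ℝ} (T : Estimator n)
    (hT : maxTotRegret (boundedPriors h) ℓ T ≤ (B : EReal)) : RegretBound h ℓ n B :=
  ⟨(iInf_le _ T).trans hT, T, hT⟩

lemma RegretBound.mono {h : ℝ} {ℓ : ℝ → ℝ} {n : ℕ} {B B' : ℝ} (hb : RegretBound h ℓ n B)
    (hB : B ≤ B') : RegretBound h ℓ n B' :=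
  ⟨hb.1.trans (EReal.coe_le_coe_iff.2 hB), hb.2.imp fun _ hT =>
    hT.trans (EReal.coe_le_coe_iff.2 hB)⟩

lemma mmse_sub_const (π : ProbabilityMeasure ℝ≥0) (ℓ : ℝ → ℝ) (c : ℝ) :
    mmse π (fun θ => ℓ θ - c) = mmse π ℓ := by
  refine le_antisymm (le_iInf fun t => (iInf_le _ fun x => t x - c).trans (le_of_eq ?_))
    (le_iInf fun t => (iInf_le _ fun x => t x + c).trans (le_of_eq ?_)) <;>
  exact lintegral_congr fun z => by ring_nf

/-- Shifting both target and estimator leaves all errors unchanged. This disposes of the constant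
term in the third part, on which no bound is assumed. -/
lemma RegretBound.of_sub_const {h : ℝ} {ℓ : ℝ → ℝ} {n : ℕ} {B : ℝ} (c : ℝ)
    (hb : RegretBound h (fun θ => ℓ θ - c) n B) : RegretBound h ℓ n B := by
  obtain ⟨T, hT⟩ := hb.2
  refine RegretBound.of_maxTotRegret_le (fun X j => T X j + c) (le_trans (le_of_eq ?_) hT)
  refine iSup_congr fun π => iSup_congr fun _ => ?_
  rw [totRegret, totRegret, mmse_sub_const, totalRisk, totalRisk]
  congr 2
  refine lintegral_congr fun ω => congrArg _ (Finset.sum_congr rfl fun j _ => ?_)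
  ring

/-- The regret bound for the Robbins-type estimator in simplified form. -/
theorem regretBound_of_approx {h : ℝ} (hh : 0 < h) {ℓ : ℝ → ℝ}
    (hℓ : ContinuousOn ℓ (Icc 0 h)) (b : ℕ → ℝ) (k : ℕ) {M ε : ℝ}
    (hM : ∀ θ ∈ Icc 0 h, |∑ m ∈ Finset.range (k + 1), b m * θ ^ m| ≤ M)
    (hε : ∀ θ ∈ Icc 0 h, |ℓ θ - ∑ m ∈ Finset.range (k + 1), b m * θ ^ m| ≤ ε) (K : ℕ) {n : ℕ}
    (hn : 2 ≤ n) :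
    RegretBound h ℓ n (2 * n * ε ^ 2 + (K + 1) * (48 * M ^ 2 + 16 * varianceProxy b k h K) +
        8 * M ^ 2 * n * (h ^ (K + 1) / (K + 1).factorial)) := by
  obtain ⟨n, rfl⟩ : ∃ m, n = m + 1 := ⟨n - 1, by omega⟩
  refine RegretBound.of_maxTotRegret_le _ ((maxTotRegret_robbinsEstimator_le hh hℓ b k hM hε K
    (by omega : 0 < n)).trans (EReal.coe_le_coe_iff.2 ?_))
  have hS := varianceProxy_nonneg b k hh.le K
  have hn1 : (1 : ℝ) ≤ n := by exact_mod_cast (by omega : 1 ≤ n)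
  -- Here `n` is the size of the leave-one-out sample; `(n + 1) / n ≤ 2` doubles the constants.
  have h1 : ((n : ℝ) + 1) * ((24 * M ^ 2 + 8 * varianceProxy b k h K) / n) ≤
      48 * M ^ 2 + 16 * varianceProxy b k h K := by
    rw [mul_div_assoc', div_le_iff₀ (by linarith)]
    nlinarith [sq_nonneg M]
  push_cast
  nlinarith

end PoissonEB

/-! ### Coefficients of polynomials bounded on an interval -/

namespace Polynomial

lemma prod_two_mul_add_one_mul (m : ℕ) :
    (∏ l ∈ Finset.range m, (2 * (l : ℝ) + 1)) * (2 ^ m * m.factorial) = (2 * m).factorial := by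
  induction m with
  | zero => simp
  | succ m ih =>
    rw [Finset.prod_range_succ, show 2 * (m + 1) = 2 * m + 1 + 1 by ring, Nat.factorial_succ,
      Nat.factorial_succ, Nat.factorial_succ]
    push_cast
    rw [← ih]
    ring

/-- The derivative is `∏ (k² - l²) / (2 l + 1)` over `l < m`, hence at most `k^(2m) / (2m-1)!!`. Now
`(2m-1)!! 2^m m! = (2m)!` and `k^(2m) / (2m)! ≤ e^k`. -/
lemma iterate_derivative_T_eval_one_le {k m : ℕ} (hm : m ≤ k) :
    (derivative^[m] (Chebyshev.T ℝ k)).eval 1 ≤ 2 ^ m * m.factorial * Real.exp k := by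
  have h1 := Chebyshev.iterate_derivative_T_eval_one (R := ℝ) k m
  have hprod := prod_two_mul_add_one_mul m
  set D := ∏ l ∈ Finset.range m, (2 * (l : ℝ) + 1) with hD
  have hDpos : 0 < D := Finset.prod_pos fun l _ => by positivity
  have h2 : D * (derivative^[m] (Chebyshev.T ℝ k)).eval 1 ≤ (k : ℝ) ^ (2 * m) := by
    calc D * (derivative^[m] (Chebyshev.T ℝ k)).eval 1
        = ∏ l ∈ Finset.range m, ((k : ℝ) ^ 2 - (l : ℝ) ^ 2) := by
          rw [hD]; push_cast at h1; exact h1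
      _ ≤ ∏ _l ∈ Finset.range m, (k : ℝ) ^ 2 := by
          refine Finset.prod_le_prod (fun l hl => ?_) fun l _ => by nlinarith [sq_nonneg (l : ℝ)]
          have : (l : ℝ) ≤ k := by exact_mod_cast ((Finset.mem_range.1 hl).le.trans hm)
          have : (0 : ℝ) ≤ l := by positivity
          nlinarith
      _ = (k : ℝ) ^ (2 * m) := by rw [Finset.prod_const, Finset.card_range, pow_mul]
  have h3 := Real.pow_div_factorial_le_exp (k : ℝ) (by positivity) (2 * m)
  rw [div_le_iff₀ (by positivity), ← hprod] at h3
  refine le_of_mul_le_mul_left (h2.trans (h3.trans (le_of_eq ?_))) hDpos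
  ring

/-- A bound for the coefficients of a polynomial which is bounded on `[0, h]`. -/
lemma abs_coeff_le_of_abs_eval_le {h M : ℝ} (hh : 0 < h) (hM : 0 < M) {k : ℕ} {P : ℝ[X]}
    (hk : P.natDegree ≤ k) (hP : ∀ x ∈ Icc 0 h, |P.eval x| ≤ M) (m : ℕ) :
    |P.coeff m| ≤ M * (4 / h) ^ m * Real.exp k := by
  rcases lt_or_ge k m with hmk | hmk
  · rw [coeff_eq_zero_of_natDegree_lt (hk.trans_lt hmk), abs_zero]
    positivity
  -- The substitution `x = (h / 2) (1 - s)` carries `[-1, 1]` to `[0, h]` and `s = 1` to `0`, so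
  -- coefficients become derivatives at `1`, where Chebyshev polynomials are extremal. The bound is
  -- one-sided and is applied to `P` and `-P`.
  have key : ∀ Q : ℝ[X], Q.natDegree ≤ k → (∀ x ∈ Icc 0 h, |Q.eval x| ≤ M) →
      (-1) ^ m * Q.coeff m ≤ M * (4 / h) ^ m * Real.exp k := by
    intro Q hQk hQ
    set S := Q.comp (C (h / 2) * X) with hS
    set R := C M⁻¹ * S.comp (1 - X) with hR
    have hdeg : R.degree ≤ k := by
      refine natDegree_le_iff_degree_le.1 ?_
      have e1 : (1 - X : ℝ[X]).natDegree = 1 := by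
        rw [natDegree_sub_eq_right_of_natDegree_lt] <;> simp
      have e2 : (S.comp (1 - X)).natDegree ≤ S.natDegree * (1 - X : ℝ[X]).natDegree :=
        natDegree_comp_le
      have e3 : S.natDegree ≤ Q.natDegree * (C (h / 2) * X).natDegree := natDegree_comp_le
      have e4 : (C (h / 2) * X : ℝ[X]).natDegree ≤ 1 := (natDegree_C_mul_le _ _).trans natDegree_X_le
      rw [e1, mul_one] at e2
      have e5 : R.natDegree ≤ (S.comp (1 - X)).natDegree := natDegree_C_mul_le _ _
      nlinarith
    have hbd : ∀ x ∈ Icc (-1 : ℝ) 1, |R.eval x| ≤ 1 := by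
      intro x hx
      have hx' : h / 2 * (1 - x) ∈ Icc 0 h := ⟨by nlinarith [hx.2], by nlinarith [hx.1]⟩
      have := hQ _ hx'
      rw [hR, hS]
      simp only [eval_mul, eval_C, eval_comp, eval_X, eval_sub, eval_one]
      rw [abs_mul, abs_of_pos (inv_pos.2 hM)]
      rw [inv_mul_le_iff₀ hM, mul_one]
      exact this
    have h1 := (Chebyshev.eval_iterate_derivative_le_of_forall_abs_le_one (k := m) (x := 1) le_rfl
      hdeg hbd).trans (iterate_derivative_T_eval_one_le hmk)
    have h2 : (derivative^[m] R).eval 1 =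
        M⁻¹ * ((-1) ^ m * (m.factorial * (Q.coeff m * (h / 2) ^ m))) := by
      rw [hR, iterate_derivative_C_mul, iterate_derivative_comp_one_sub_X]
      simp only [eval_mul, eval_C, eval_comp, eval_pow, eval_neg, eval_one, eval_sub, eval_X,
        sub_self]
      rw [← coeff_zero_eq_eval_zero, coeff_iterate_derivative, zero_add, Nat.descFactorial_self,
        hS, comp_C_mul_X_coeff, nsmul_eq_mul]
    rw [h2] at h1
    have h3 : (4 / h) ^ m * (h / 2) ^ m = 2 ^ m := by
      rw [← mul_pow]; congr 1; field_simp; norm_num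
    have hpos : 0 < M⁻¹ * m.factorial * (h / 2) ^ m := by positivity
    refine le_of_mul_le_mul_left (a := M⁻¹ * m.factorial * (h / 2) ^ m) ?_ hpos
    calc M⁻¹ * m.factorial * (h / 2) ^ m * ((-1) ^ m * Q.coeff m)
        = M⁻¹ * ((-1) ^ m * (m.factorial * (Q.coeff m * (h / 2) ^ m))) := by ring
      _ ≤ 2 ^ m * m.factorial * Real.exp k := h1
      _ = M⁻¹ * m.factorial * (h / 2) ^ m * (M * (4 / h) ^ m * Real.exp k) := by
          rw [← h3]; field_simp
  have h1 := key P hk hP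
  have h2 := key (-P) (by rwa [natDegree_neg]) (fun x hx => by rw [eval_neg, abs_neg]; exact hP x hx)
  rw [coeff_neg] at h2
  have h3 : |P.coeff m| = |(-1) ^ m * P.coeff m| := by rw [abs_mul, abs_neg_one_pow, one_mul]
  rw [h3]
  exact abs_le.2 ⟨by linarith, h1⟩

/-! ### Jackson's theorem -/

/-- The polynomial `D` with `u D(u) = sin ((2 N + 1) φ)` at `u = sin φ`. -/
noncomputable def dirichletPoly (N : ℕ) : ℝ[X] :=
  1 + ∑ j ∈ Finset.range N, C 2 * (Chebyshev.T ℝ (j + 1 : ℕ)).comp (1 - C 2 * X ^ 2)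

lemma natDegree_dirichletPoly_le (N : ℕ) : (dirichletPoly N).natDegree ≤ 2 * N := by
  refine (natDegree_add_le _ _).trans (max_le (by simp) ?_)
  refine natDegree_sum_le_of_forall_le _ _ fun j hj => ?_
  refine (natDegree_C_mul_le _ _).trans (natDegree_comp_le.trans ?_)
  have h1 : (1 - C 2 * X ^ 2 : ℝ[X]).natDegree ≤ 2 := by compute_degree
  have h2 : (Chebyshev.T ℝ (j + 1 : ℕ)).natDegree = j + 1 := by
    rw [Chebyshev.natDegree_T, Int.natAbs_natCast]
  rw [h2]
  have := Finset.mem_range.1 hj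
  nlinarith

lemma eval_dirichletPoly_sin (N : ℕ) (φ : ℝ) : (dirichletPoly N).eval (Real.sin φ) =
    1 + ∑ j ∈ Finset.range N, 2 * Real.cos (2 * (j + 1) * φ) := by
  rw [dirichletPoly, eval_add, eval_one, eval_finsetSum]
  congr 1
  refine Finset.sum_congr rfl fun j _ => ?_
  have e : (1 - 2 * Real.sin φ ^ 2) = Real.cos (2 * φ) := by
    rw [Real.cos_two_mul, Real.cos_sq']; ring
  simp only [eval_mul, eval_C, eval_comp, eval_sub, eval_one, eval_pow, eval_X]
  rw [e, Chebyshev.T_real_cos]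
  push_cast
  ring_nf

lemma sin_mul_eval_dirichletPoly (N : ℕ) (φ : ℝ) :
    Real.sin φ * (dirichletPoly N).eval (Real.sin φ) = Real.sin ((2 * N + 1) * φ) := by
  rw [eval_dirichletPoly_sin]
  induction N with
  | zero => simp
  | succ N ih =>
    rw [Finset.sum_range_succ, ← add_assoc, mul_add, ih]
    have h1 := Real.sin_sub_sin ((2 * (N + 1) + 1) * φ) ((2 * N + 1) * φ)
    have e1 : ((2 * (N + 1) + 1) * φ - (2 * N + 1) * φ) / 2 = φ := by ring
    have e2 : ((2 * (N + 1) + 1) * φ + (2 * N + 1) * φ) / 2 = 2 * (N + 1) * φ := by ring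
    rw [e1, e2] at h1
    push_cast
    linarith

lemma abs_sin_nat_mul_le (n : ℕ) (φ : ℝ) : |Real.sin (n * φ)| ≤ n * |Real.sin φ| := by
  induction n with
  | zero => simp
  | succ n ih =>
    push_cast
    rw [add_mul, one_mul, Real.sin_add]
    refine (abs_add_le _ _).trans ?_
    rw [abs_mul, abs_mul]
    nlinarith [Real.abs_cos_le_one φ, Real.abs_cos_le_one (n * φ), abs_nonneg (Real.sin φ),
      abs_nonneg (Real.sin (n * φ)), abs_nonneg (Real.cos φ), abs_nonneg (Real.cos (n * φ))]

lemma exists_sin_eq {u : ℝ} (hu : |u| ≤ 1) : ∃ φ, Real.sin φ = u :=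
  ⟨Real.arcsin u, Real.sin_arcsin (abs_le.1 hu).1 (abs_le.1 hu).2⟩

lemma abs_eval_dirichletPoly_le {N : ℕ} (hN : 1 ≤ N) {u : ℝ} (hu : |u| ≤ 1) :
    |(dirichletPoly N).eval u| ≤ 3 * N := by
  obtain ⟨φ, rfl⟩ := exists_sin_eq hu
  rw [eval_dirichletPoly_sin]
  have h1 : |∑ j ∈ Finset.range N, 2 * Real.cos (2 * (j + 1) * φ)| ≤ ∑ j ∈ Finset.range N, 2 := by
    refine (Finset.abs_sum_le_sum_abs _ _).trans (Finset.sum_le_sum fun j _ => ?_)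
    rw [abs_mul, abs_two]
    linarith [Real.abs_cos_le_one (2 * (j + 1) * φ)]
  simp only [Finset.sum_const, Finset.card_range, nsmul_eq_mul] at h1
  have h2 := abs_add_le 1 (∑ j ∈ Finset.range N, 2 * Real.cos (2 * (j + 1) * φ))
  have h3 : (1 : ℝ) ≤ N := by exact_mod_cast hN
  rw [abs_one] at h2
  linarith

lemma abs_mul_eval_dirichletPoly_le (N : ℕ) {u : ℝ} (hu : |u| ≤ 1) :
    |u * (dirichletPoly N).eval u| ≤ 1 := by
  obtain ⟨φ, rfl⟩ := exists_sin_eq hu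
  rw [sin_mul_eval_dirichletPoly]
  exact Real.abs_sin_le_one _

/-- For such `u = sin φ` every `|sin ((j+1) φ)|` is at most `1 / 2`, so every summand `2 cos (2
(j+1) φ)` is at least `1`. -/
lemma le_eval_dirichletPoly {N : ℕ} (hN : 1 ≤ N) {u : ℝ} (hu : |u| ≤ 1 / (2 * N)) :
    (N : ℝ) ≤ (dirichletPoly N).eval u := by
  have hN' : (1 : ℝ) ≤ N := by exact_mod_cast hN
  have hu1 : |u| ≤ 1 := hu.trans (by rw [div_le_one (by positivity)]; linarith)
  obtain ⟨φ, rfl⟩ := exists_sin_eq hu1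
  rw [eval_dirichletPoly_sin]
  have h1 : ∑ j ∈ Finset.range N, (1 : ℝ) ≤
      ∑ j ∈ Finset.range N, 2 * Real.cos (2 * (j + 1) * φ) := by
    refine Finset.sum_le_sum fun j hj => ?_
    have e1 : Real.cos (2 * (j + 1) * φ) = 1 - 2 * Real.sin ((j + 1) * φ) ^ 2 := by
      rw [mul_assoc, Real.cos_two_mul, Real.cos_sq']; ring
    have e2 := abs_sin_nat_mul_le (j + 1) φ
    push_cast at e2
    have e3 : ((j : ℝ) + 1) ≤ N := by exact_mod_cast Finset.mem_range.1 hj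
    have e4 : |Real.sin ((j + 1) * φ)| ≤ 1 / 2 := by
      refine e2.trans ((mul_le_mul e3 hu (abs_nonneg _) (by positivity)).trans (le_of_eq ?_))
      field_simp
    have e5 : Real.sin ((j + 1) * φ) ^ 2 ≤ (1 / 2) ^ 2 := by
      rw [← sq_abs]; exact pow_le_pow_left₀ (abs_nonneg _) e4 2
    rw [e1]
    linarith
  simp at h1
  linarith

/-- The Jackson-type kernel `D⁴`. -/
noncomputable def jacksonPoly (N : ℕ) : ℝ[X] := dirichletPoly N ^ 4

lemma natDegree_jacksonPoly_le (N : ℕ) : (jacksonPoly N).natDegree ≤ 8 * N := by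
  refine natDegree_pow_le.trans ?_
  have := natDegree_dirichletPoly_le N
  omega

lemma eval_jacksonPoly_nonneg (N : ℕ) (u : ℝ) : 0 ≤ (jacksonPoly N).eval u := by
  rw [jacksonPoly, eval_pow]; positivity

lemma integral_jacksonPoly_ge {N : ℕ} (hN : 1 ≤ N) :
    (N : ℝ) ^ 3 ≤ ∫ u in (-1 : ℝ)..1, (jacksonPoly N).eval u := by
  have hN' : (1 : ℝ) ≤ N := by exact_mod_cast hN
  have hd1 : 1 / (2 * (N : ℝ)) ≤ 1 := by rw [div_le_one (by positivity)]; linarith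
  have hd0 : 0 < 1 / (2 * (N : ℝ)) := by positivity
  set d := 1 / (2 * (N : ℝ)) with hd
  have hc : Continuous fun u => (jacksonPoly N).eval u := (jacksonPoly N).continuous
  have h1 : ∫ u in (-d)..d, (N : ℝ) ^ 4 ≤ ∫ u in (-d)..d, (jacksonPoly N).eval u := by
    refine intervalIntegral.integral_mono_on (by linarith) (by simp) (hc.intervalIntegrable _ _) ?_
    intro u hu
    rw [jacksonPoly, eval_pow]
    exact pow_le_pow_left₀ (by positivity) (le_eval_dirichletPoly hN (abs_le.2 hu)) 4
  have h2 : ∫ u in (-d)..d, (jacksonPoly N).eval u ≤ ∫ u in (-1 : ℝ)..1, (jacksonPoly N).eval u := by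
    refine intervalIntegral.integral_mono_interval (by linarith) (by linarith) hd1
      (ae_of_all _ fun u => eval_jacksonPoly_nonneg N u) (hc.intervalIntegrable _ _)
  refine le_trans (le_of_eq ?_) (h1.trans h2)
  rw [intervalIntegral.integral_const, smul_eq_mul, hd]
  field_simp
  ring

/-- Combines `|D| ≤ 3 N` with `|u D| ≤ 1`. After multiplication by `|u|`, the fourth power still
leaves decay like `(N u)⁻²`, so the first moment is `O(N²)` while the mass is at least `N³`: the
kernel lives at scale `1 / N`. -/
lemma abs_mul_eval_jacksonPoly_le {N : ℕ} (hN : 1 ≤ N) {u : ℝ} (hu : |u| ≤ 1) :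
    |u| * (jacksonPoly N).eval u ≤ 162 * N ^ 3 * (1 + (N * u) ^ 2)⁻¹ := by
  have hN' : (1 : ℝ) ≤ N := by exact_mod_cast hN
  have hA := abs_eval_dirichletPoly_le hN hu
  have hB := abs_mul_eval_dirichletPoly_le N hu
  rw [abs_mul] at hB
  rw [jacksonPoly, eval_pow]
  set D := (dirichletPoly N).eval u
  have hD : D ^ 4 = |D| ^ 4 := by rw [← abs_pow, abs_of_nonneg (by positivity)]
  rw [hD, ← div_eq_mul_inv, le_div_iff₀ (by positivity)]
  have hu0 := abs_nonneg u
  have hD0 := abs_nonneg D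
  set v := |u| with hv
  set E := |D| with hE
  have hvu : (N * u) ^ 2 = N ^ 2 * v ^ 2 := by rw [hv, sq_abs]; ring
  rw [hvu]
  have h1 : v * E ^ 4 * (N ^ 2 * v ^ 2) ≤ 3 * N ^ 3 := by
    have : v * E ^ 4 * (N ^ 2 * v ^ 2) = N ^ 2 * E * (v * E) ^ 3 := by ring
    rw [this]
    have h2 : (v * E) ^ 3 ≤ 1 := pow_le_one₀ (by positivity) hB
    calc (N : ℝ) ^ 2 * E * (v * E) ^ 3 ≤ N ^ 2 * (3 * N) * 1 := by gcongr
      _ = _ := by ring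
  have h3 : v * E ^ 4 ≤ 27 * N ^ 3 := by
    calc v * E ^ 4 = (v * E) * E ^ 3 := by ring
      _ ≤ (1 : ℝ) * (3 * (N : ℝ)) ^ 3 := by gcongr
      _ = _ := by ring
  have h4 : (0 : ℝ) ≤ N ^ 3 := by positivity
  nlinarith

lemma integral_abs_mul_jacksonPoly_le {N : ℕ} (hN : 1 ≤ N) :
    ∫ u in (-1 : ℝ)..1, |u| * (jacksonPoly N).eval u ≤ 648 * N ^ 2 := by
  have hN' : (1 : ℝ) ≤ N := by exact_mod_cast hN
  have hc : Continuous fun u => |u| * (jacksonPoly N).eval u :=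
    continuous_abs.mul (jacksonPoly N).continuous
  have hc2 : Continuous fun u : ℝ => 162 * (N : ℝ) ^ 3 * (1 + (N * u) ^ 2)⁻¹ := by
    refine continuous_const.mul (Continuous.inv₀ (by fun_prop) fun u => ?_)
    positivity
  have h1 : ∫ u in (-1 : ℝ)..1, |u| * (jacksonPoly N).eval u ≤
      ∫ u in (-1 : ℝ)..1, 162 * (N : ℝ) ^ 3 * (1 + (N * u) ^ 2)⁻¹ :=
    intervalIntegral.integral_mono_on (by norm_num) (hc.intervalIntegrable _ _)
      (hc2.intervalIntegrable _ _) fun u hu => abs_mul_eval_jacksonPoly_le hN (abs_le.2 hu)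
  refine h1.trans ?_
  rw [intervalIntegral.integral_const_mul,
    intervalIntegral.integral_comp_mul_left (fun v => (1 + v ^ 2)⁻¹) (by positivity),
    integral_inv_one_add_sq, smul_eq_mul]
  have h2 := Real.arctan_lt_pi_div_two (N * 1)
  have h3 := Real.neg_pi_div_two_lt_arctan (N * (-1))
  have h4 := Real.pi_le_four
  calc 162 * (N : ℝ) ^ 3 * ((N : ℝ)⁻¹ * (Real.arctan (N * 1) - Real.arctan (N * (-1))))
      = 162 * (N : ℝ) ^ 2 * (Real.arctan (N * 1) - Real.arctan (N * (-1))) := by field_simp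
    _ ≤ 162 * (N : ℝ) ^ 2 * 4 := by gcongr; linarith
    _ = _ := by ring

/-- The convolution of a continuous function on `[a, b]` with a polynomial is a polynomial. -/
lemma exists_eval_eq_integral_mul_eval_sub {g : ℝ → ℝ} (hg : Continuous g) (a b : ℝ) (Q : ℝ[X]) :
    ∃ P : ℝ[X], P.natDegree ≤ Q.natDegree ∧
      ∀ x, P.eval x = ∫ y in a..b, g y * Q.eval (x - y) := by
  refine ⟨∑ i ∈ Finset.range (Q.natDegree + 1), ∑ j ∈ Finset.range (i + 1),
    C (Q.coeff i * i.choose j * ∫ y in a..b, g y * (-y) ^ (i - j)) * X ^ j, ?_, fun x => ?_⟩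
  · refine natDegree_sum_le_of_forall_le _ _ fun i hi => natDegree_sum_le_of_forall_le _ _
      fun j hj => (natDegree_C_mul_X_pow_le _ _).trans ?_
    have := Finset.mem_range.1 hi
    have := Finset.mem_range.1 hj
    omega
  · have e : ∀ y, g y * Q.eval (x - y) = ∑ i ∈ Finset.range (Q.natDegree + 1),
        ∑ j ∈ Finset.range (i + 1), (Q.coeff i * i.choose j * x ^ j) * (g y * (-y) ^ (i - j)) := by
      intro y
      rw [eval_eq_sum_range, Finset.mul_sum]
      refine Finset.sum_congr rfl fun i _ => ?_
      rw [sub_eq_add_neg, add_pow, Finset.mul_sum, Finset.mul_sum]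
      exact Finset.sum_congr rfl fun j _ => by ring
    have hint : ∀ i j : ℕ, IntervalIntegrable
        (fun y => (Q.coeff i * i.choose j * x ^ j) * (g y * (-y) ^ (i - j))) volume a b :=
      fun i j => Continuous.intervalIntegrable (by fun_prop) _ _
    simp_rw [e]
    rw [intervalIntegral.integral_finsetSum fun i _ =>
      Continuous.intervalIntegrable (by fun_prop) _ _, eval_finsetSum]
    refine Finset.sum_congr rfl fun i _ => ?_
    rw [intervalIntegral.integral_finsetSum fun j _ => hint i j, eval_finsetSum]
    refine Finset.sum_congr rfl fun j _ => ?_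
    rw [intervalIntegral.integral_const_mul]
    simp only [eval_mul, eval_C, eval_pow, eval_X]
    ring

/-- Approximation of a function on the line, Hölder continuous and vanishing at a point
of `[0, h]`, by its convolution with the Jackson-type kernel. -/
lemma exists_natDegree_le_abs_sub_eval_le_of_line {h α L B : ℝ} (hh : 0 < h) (hα : 0 < α)
    (hα1 : α ≤ 1) (hL : 0 ≤ L) {g : ℝ → ℝ} (hgc : Continuous g)
    (hg : ∀ x y, |g x - g y| ≤ L * |x - y| ^ α) (hB : ∀ x ∈ Icc 0 h, |g x| ≤ B)
    {N : ℕ} (hN : 1 ≤ N) :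
    ∃ P : ℝ[X], P.natDegree ≤ 8 * N ∧
      ∀ x ∈ Icc 0 h, |g x - P.eval x| ≤ (649 * (L * (2 * h) ^ α) + 2592 * B) * (N : ℝ) ^ (-α) := by
  have hN' : (1 : ℝ) ≤ N := by exact_mod_cast hN
  have hN0 : (0 : ℝ) < N := by linarith
  have hB0 : 0 ≤ B := (abs_nonneg _).trans (hB 0 ⟨le_rfl, hh.le⟩)
  set Q := jacksonPoly N with hQ
  set c := ∫ u in (-1 : ℝ)..1, Q.eval u with hc
  have hcN : (N : ℝ) ^ 3 ≤ c := integral_jacksonPoly_ge hN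
  have hc0 : 0 < c := lt_of_lt_of_le (by positivity) hcN
  have hQc : Continuous fun u => Q.eval u := Q.continuous
  have hQ0 : ∀ u, 0 ≤ Q.eval u := eval_jacksonPoly_nonneg N
  set I := ∫ u in (-1 : ℝ)..1, |u| * Q.eval u with hI
  have hIN : I ≤ 648 * N ^ 2 := integral_abs_mul_jacksonPoly_le hN
  have hIc : Continuous fun u => |u| * Q.eval u := continuous_abs.mul hQc
  have hI0 : ∀ u, 0 ≤ |u| * Q.eval u := fun u => mul_nonneg (abs_nonneg _) (hQ0 u)
  -- For `x` in `[0, h]` and `y` in `[-h, 2h]`, the variable `u = (x - y) / (2h)` runs over an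
  -- interval between `[-1/2, 1/2]` and `[-1, 1]`: the kernel bounds apply, and the part cut off has
  -- `|u| ≥ 1 / 2`.
  obtain ⟨P, hPd, hP⟩ := exists_eval_eq_integral_mul_eval_sub hgc (-h) (2 * h)
    (Q.comp (C (2 * h)⁻¹ * X))
  refine ⟨C (2 * h * c)⁻¹ * P, ?_, fun x hx => ?_⟩
  · have e1 : (Q.comp (C (2 * h)⁻¹ * X)).natDegree ≤ Q.natDegree * (C (2 * h)⁻¹ * X).natDegree :=
      natDegree_comp_le
    have e2 : (C (2 * h)⁻¹ * X : ℝ[X]).natDegree ≤ 1 :=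
      (natDegree_C_mul_le _ _).trans natDegree_X_le
    have e3 := natDegree_jacksonPoly_le N
    refine (natDegree_C_mul_le _ _).trans (hPd.trans (e1.trans ?_))
    nlinarith
  set lo := (x - 2 * h) / (2 * h) with hlo
  set hi := (x + h) / (2 * h) with hhi
  have hlo1 : -1 ≤ lo := by rw [hlo, le_div_iff₀ (by positivity)]; linarith [hx.1]
  have hlo2 : lo ≤ -(1 / 2) := by rw [hlo, div_le_iff₀ (by positivity)]; linarith [hx.2]
  have hhi1 : hi ≤ 1 := by rw [hhi, div_le_iff₀ (by positivity)]; linarith [hx.2]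
  have hhi2 : 1 / 2 ≤ hi := by rw [hhi, le_div_iff₀ (by positivity)]; linarith [hx.1]
  have hPx : P.eval x = 2 * h * ∫ u in lo..hi, g (x - 2 * h * u) * Q.eval u := by
    have e := intervalIntegral.integral_comp_sub_mul (a := lo) (b := hi)
      (fun y => g y * Q.eval ((2 * h)⁻¹ * (x - y))) (c := 2 * h) (by positivity) x
    have e1 : x - 2 * h * hi = -h := by rw [hhi]; field_simp; ring
    have e2 : x - 2 * h * lo = 2 * h := by rw [hlo]; field_simp; ring
    rw [e1, e2] at e
    rw [hP]
    simp only [eval_comp, eval_mul, eval_C, eval_X]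
    have e3 : ∀ u, (2 * h)⁻¹ * (x - (x - 2 * h * u)) = u := fun u => by field_simp; ring
    simp only [e3] at e
    rw [e, smul_eq_mul, mul_inv_cancel_left₀ (by positivity)]
  set A := ∫ u in lo..hi, g (x - 2 * h * u) * Q.eval u with hA
  have hsplit : c = (∫ u in (-1 : ℝ)..lo, Q.eval u) + (∫ u in lo..hi, Q.eval u) +
      ∫ u in hi..1, Q.eval u := by
    rw [intervalIntegral.integral_add_adjacent_intervals (hQc.intervalIntegrable _ _)
      (hQc.intervalIntegrable _ _), intervalIntegral.integral_add_adjacent_intervals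
      (hQc.intervalIntegrable _ _) (hQc.intervalIntegrable _ _)]
  -- On the part cut off `1 ≤ 2 |u|`, so its mass is bounded by the first moment, which is `O(c /
  -- N)`.
  have htail : ∀ p q : ℝ, -1 ≤ p → p ≤ q → q ≤ 1 → (∀ u ∈ Icc p q, 1 / 2 ≤ |u|) →
      ∫ u in p..q, Q.eval u ≤ 2 * I := by
    intro p q hp hpq hq hu
    have h1 : ∫ u in p..q, Q.eval u ≤ ∫ u in p..q, 2 * (|u| * Q.eval u) :=
      intervalIntegral.integral_mono_on hpq (hQc.intervalIntegrable _ _)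
        ((hIc.const_mul 2).intervalIntegrable _ _) fun u hu' => by
          nlinarith [hu u hu', hQ0 u]
    rw [intervalIntegral.integral_const_mul] at h1
    have h2 : ∫ u in p..q, |u| * Q.eval u ≤ I :=
      intervalIntegral.integral_mono_interval hp hpq hq (ae_of_all _ hI0)
        (hIc.intervalIntegrable _ _)
    linarith
  have ht1 := htail (-1) lo le_rfl hlo1 (by linarith) fun u hu => by
    rw [abs_of_nonpos (by linarith [hu.2])]; linarith [hu.2]
  have ht2 := htail hi 1 (by linarith) hhi1 le_rfl fun u hu => by
    rw [abs_of_nonneg (by linarith [hu.1])]; linarith [hu.1]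
  have hmid : |g x * (∫ u in lo..hi, Q.eval u) - A| ≤
      L * (2 * h) ^ α * (N : ℝ) ^ (-α) * (c + N * I) := by
    have hgx : Continuous fun u => g (x - 2 * h * u) * Q.eval u := by fun_prop
    have hgx2 : Continuous fun u => g x * Q.eval u := by fun_prop
    rw [← intervalIntegral.integral_const_mul, hA,
      ← intervalIntegral.integral_sub (hgx2.intervalIntegrable _ _) (hgx.intervalIntegrable _ _)]
    have hdom : Continuous fun u => L * (2 * h) ^ α * (N : ℝ) ^ (-α) *
        (Q.eval u + N * (|u| * Q.eval u)) := by fun_prop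
    have h1 : |∫ u in lo..hi, (g x * Q.eval u - g (x - 2 * h * u) * Q.eval u)| ≤
        ∫ u in lo..hi, L * (2 * h) ^ α * (N : ℝ) ^ (-α) * (Q.eval u + N * (|u| * Q.eval u)) := by
      refine (intervalIntegral.abs_integral_le_integral_abs (by linarith)).trans
        (intervalIntegral.integral_mono_on (by linarith)
        ((hgx2.sub hgx).abs.intervalIntegrable _ _) (hdom.intervalIntegrable _ _) fun u _ => ?_)
      rw [← sub_mul, abs_mul, abs_of_nonneg (hQ0 u)]
      have h2 := hg x (x - 2 * h * u)
      have h3 : |x - (x - 2 * h * u)| = 2 * h * |u| := by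
        rw [sub_sub_cancel, abs_mul, abs_of_pos (by positivity)]
      -- This reduces the moment of order `α` to the mass and the first moment.
      have h4 : (N * |u|) ^ α ≤ 1 + N * |u| := by
        have hv : 0 ≤ N * |u| := by positivity
        rcases le_total (N * |u|) 1 with h5 | h5
        · linarith [Real.rpow_le_one hv h5 hα.le]
        · have := Real.rpow_le_rpow_of_exponent_le h5 hα1
          rw [Real.rpow_one] at this
          linarith
      have h5 : |u| ^ α = (N : ℝ) ^ (-α) * (N * |u|) ^ α := by
        rw [Real.mul_rpow hN0.le (abs_nonneg _), ← mul_assoc, ← Real.rpow_add hN0]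
        simp
      rw [h3, Real.mul_rpow (by positivity) (abs_nonneg _), h5] at h2
      calc |g x - g (x - 2 * h * u)| * Q.eval u
          ≤ L * ((2 * h) ^ α * ((N : ℝ) ^ (-α) * (N * |u|) ^ α)) * Q.eval u :=
            mul_le_mul_of_nonneg_right h2 (hQ0 u)
        _ ≤ L * ((2 * h) ^ α * ((N : ℝ) ^ (-α) * (1 + N * |u|))) * Q.eval u := by
            have := hQ0 u
            gcongr
        _ = _ := by ring
    refine h1.trans ?_
    have hsum : Continuous fun u => Q.eval u + N * (|u| * Q.eval u) := by fun_prop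
    rw [intervalIntegral.integral_const_mul]
    refine mul_le_mul_of_nonneg_left ?_ (by positivity)
    have h2 : ∫ u in lo..hi, (Q.eval u + N * (|u| * Q.eval u)) ≤
        ∫ u in (-1 : ℝ)..1, (Q.eval u + N * (|u| * Q.eval u)) :=
      intervalIntegral.integral_mono_interval hlo1 (by linarith) hhi1
        (ae_of_all _ fun u => add_nonneg (hQ0 u) (mul_nonneg hN0.le (hI0 u)))
        (hsum.intervalIntegrable _ _)
    refine h2.trans (le_of_eq ?_)
    rw [intervalIntegral.integral_add (hQc.intervalIntegrable _ _)
      ((hIc.const_mul _).intervalIntegrable _ _), intervalIntegral.integral_const_mul]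
  have hNI : N * I ≤ 648 * c := by nlinarith
  have hIc' : I ≤ 648 * c * (N : ℝ) ^ (-α) := by
    have h1 : (N : ℝ)⁻¹ ≤ (N : ℝ) ^ (-α) := by
      rw [← Real.rpow_neg_one]
      exact Real.rpow_le_rpow_of_exponent_le hN' (by linarith)
    calc I = (N * I) * (N : ℝ)⁻¹ := by field_simp
      _ ≤ 648 * c * (N : ℝ)⁻¹ := by gcongr
      _ ≤ _ := by gcongr
  have heq : g x - (C (2 * h * c)⁻¹ * P).eval x = (g x * c - A) / c := by
    rw [eval_mul, eval_C, hPx]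
    field_simp
  rw [heq, abs_div, abs_of_pos hc0, div_le_iff₀ hc0]
  have hgx := hB x hx
  have hq1 : 0 ≤ ∫ u in (-1 : ℝ)..lo, Q.eval u :=
    intervalIntegral.integral_nonneg hlo1 fun u _ => hQ0 u
  have hq2 : 0 ≤ ∫ u in hi..1, Q.eval u :=
    intervalIntegral.integral_nonneg hhi1 fun u _ => hQ0 u
  have hdec : g x * c - A = (g x * (∫ u in lo..hi, Q.eval u) - A) +
      g x * ((∫ u in (-1 : ℝ)..lo, Q.eval u) + ∫ u in hi..1, Q.eval u) := by
    rw [hsplit]; ring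
  rw [hdec]
  refine (abs_add_le _ _).trans ?_
  rw [abs_mul (g x), abs_of_nonneg (add_nonneg hq1 hq2)]
  have hlast : |g x| * ((∫ u in (-1 : ℝ)..lo, Q.eval u) + ∫ u in hi..1, Q.eval u) ≤
      B * (4 * (648 * c * (N : ℝ) ^ (-α))) :=
    mul_le_mul hgx (by linarith) (add_nonneg hq1 hq2) hB0
  have hmid2 : L * (2 * h) ^ α * (N : ℝ) ^ (-α) * (c + N * I) ≤
      L * (2 * h) ^ α * (N : ℝ) ^ (-α) * (649 * c) :=
    mul_le_mul_of_nonneg_left (by linarith) (by positivity)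
  calc _ ≤ L * (2 * h) ^ α * (N : ℝ) ^ (-α) * (649 * c) + B * (4 * (648 * c * (N : ℝ) ^ (-α))) :=
        add_le_add (hmid.trans hmid2) hlast
    _ = _ := by ring

/-- Jackson's theorem for Hölder continuous functions. -/
lemma exists_natDegree_le_abs_sub_eval_le_of_holder {h α : ℝ} (hh : 0 < h) (hα : 0 < α)
    (hα1 : α ≤ 1) : ∃ C : ℝ, 0 ≤ C ∧ ∀ (L : ℝ) (f : ℝ → ℝ), 0 ≤ L →
      PoissonEB.HolderOnReal L α f (Icc 0 h) → ∀ N : ℕ, 1 ≤ N → ∃ P : ℝ[X], P.natDegree ≤ 8 * N ∧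
        ∀ x ∈ Icc 0 h, |f x - P.eval x| ≤ C * L * (N : ℝ) ^ (-α) := by
  refine ⟨649 * (2 * h) ^ α + 2592 * h ^ α, by positivity, fun L f hL hf N hN => ?_⟩
  set π : ℝ → ℝ := fun y => max 0 (min h y) with hπ
  have hπm : ∀ y, π y ∈ Icc 0 h := fun y => ⟨le_max_left _ _, max_le hh.le (min_le_left _ _)⟩
  have hπe : ∀ y ∈ Icc 0 h, π y = y := fun y hy => by
    rw [hπ]; simp only [min_eq_right hy.2, max_eq_right hy.1]
  have hπl : ∀ x y, |π x - π y| ≤ |x - y| := fun x y =>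
    (abs_max_sub_max_le_max _ _ _ _).trans (max_le (by simp) ((abs_min_sub_min_le_max _ _ _ _).trans
      (max_le (by simp) le_rfl)))
  -- Precomposing with the projection onto `[0, h]` extends `f` to the line with the same Hölder
  -- constant. Subtracting `f 0` makes the supremum at most `L h ^ α`, so the error is linear in
  -- `L`, as the induction on `p` requires.
  set g : ℝ → ℝ := fun y => f (π y) - f 0 with hg
  have hgl : ∀ x y, |g x - g y| ≤ L * |x - y| ^ α := by
    intro x y
    rw [hg, sub_sub_sub_cancel_right]
    refine (hf _ (hπm x) _ (hπm y)).trans (mul_le_mul_of_nonneg_left ?_ hL)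
    exact Real.rpow_le_rpow (abs_nonneg _) (hπl x y) hα.le
  have hgc : Continuous g := by
    refine continuous_iff_continuousAt.2 fun x => tendsto_iff_dist_tendsto_zero.2 ?_
    have h1 : Tendsto (fun y => L * |y - x| ^ α) (𝓝 x) (𝓝 (L * |x - x| ^ α)) := by
      refine ((Continuous.rpow_const (by fun_prop) fun _ => Or.inr hα.le).tendsto x).const_mul L
    rw [sub_self, abs_zero, Real.zero_rpow hα.ne', mul_zero] at h1
    exact squeeze_zero (fun _ => dist_nonneg) (fun y => hgl y x) h1
  have hgB : ∀ x ∈ Icc 0 h, |g x| ≤ L * h ^ α := by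
    intro x hx
    have h0 : g 0 = 0 := by simp [hg, hπe 0 ⟨le_rfl, hh.le⟩]
    have h1 := hgl x 0
    rw [h0, sub_zero, sub_zero] at h1
    refine h1.trans (mul_le_mul_of_nonneg_left ?_ hL)
    exact Real.rpow_le_rpow (abs_nonneg _) (by rw [abs_of_nonneg hx.1]; exact hx.2) hα.le
  obtain ⟨P, hPd, hP⟩ :=
    exists_natDegree_le_abs_sub_eval_le_of_line hh hα hα1 hL hgc hgl hgB hN
  refine ⟨P + C (f 0), (natDegree_add_C).trans_le hPd, fun x hx => ?_⟩
  have h1 := hP x hx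
  have h2 : g x = f x - f 0 := by rw [hg]; simp only [hπe x hx]
  rw [h2] at h1
  rw [eval_add, eval_C, ← sub_sub, sub_right_comm]
  refine h1.trans (le_of_eq ?_)
  ring

lemma exists_derivative_eq (q : ℝ[X]) :
    ∃ P : ℝ[X], P.natDegree ≤ q.natDegree + 1 ∧ derivative P = q := by
  refine ⟨∑ i ∈ Finset.range (q.natDegree + 1), C (q.coeff i / (i + 1)) * X ^ (i + 1), ?_, ?_⟩
  · refine natDegree_sum_le_of_forall_le _ _ fun i hi => (natDegree_C_mul_X_pow_le _ _).trans ?_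
    have := Finset.mem_range.1 hi
    omega
  · conv_rhs => rw [q.as_sum_range_C_mul_X_pow]
    rw [derivative_sum]
    refine Finset.sum_congr rfl fun i _ => ?_
    rw [derivative_C_mul_X_pow]
    congr 2
    push_cast
    field_simp

/-- Jackson's theorem for functions whose derivative of order `p` is Hölder continuous. -/
theorem exists_natDegree_le_abs_sub_eval_le {h α : ℝ} (hh : 0 < h) (hα : 0 < α) (hα1 : α ≤ 1)
    (p : ℕ) : ∃ C : ℝ, 0 ≤ C ∧ ∀ (L : ℝ) (f : ℝ → ℝ), 0 ≤ L → ContDiffOn ℝ p f (Icc 0 h) →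
      PoissonEB.HolderOnReal L α (iteratedDerivWithin p f (Icc 0 h)) (Icc 0 h) →
      ∀ N : ℕ, 1 ≤ N → ∃ P : ℝ[X], P.natDegree ≤ 8 * N + p ∧
        ∀ x ∈ Icc 0 h, |f x - P.eval x| ≤ C * L * (N : ℝ) ^ (-(p + α)) := by
  induction p with
  | zero =>
    obtain ⟨C, hC, H⟩ := exists_natDegree_le_abs_sub_eval_le_of_holder hh hα hα1
    refine ⟨C, hC, fun L f hL _ hf N hN => ?_⟩
    rw [iteratedDerivWithin_zero] at hf
    simpa using H L f hL hf N hN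
  | succ p ih =>
    obtain ⟨C, hC, H⟩ := ih
    obtain ⟨C', hC', H'⟩ := exists_natDegree_le_abs_sub_eval_le_of_holder hh one_pos le_rfl
    refine ⟨C' * C, mul_nonneg hC' hC, fun L f hL hfd hf N hN => ?_⟩
    have hN0 : (0 : ℝ) < N := by exact_mod_cast hN
    have hu : UniqueDiffOn ℝ (Icc 0 h) := uniqueDiffOn_Icc hh
    have hfd' : ContDiffOn ℝ ((p : WithTop ℕ∞) + 1) f (Icc 0 h) := by exact_mod_cast hfd
    obtain ⟨hdiff, -, hder⟩ := (contDiffOn_succ_iff_derivWithin hu).1 hfd'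
    have hf' : PoissonEB.HolderOnReal L α
        (iteratedDerivWithin p (derivWithin f (Icc 0 h)) (Icc 0 h)) (Icc 0 h) := by
      intro x hx y hy
      rw [← iteratedDerivWithin_succ']
      exact hf x hx y hy
    obtain ⟨q, hqd, hq⟩ := H L _ hL hder hf' N hN
    obtain ⟨P, hPd, hP⟩ := exists_derivative_eq q
    set ε := C * L * (N : ℝ) ^ (-(p + α)) with hε
    have hε0 : 0 ≤ ε := by positivity
    -- With `P' = q` close to the derivative of `f`, the difference `f - P` is Lipschitz with
    -- constant `ε`; approximating it once more gains a factor `1 / N`.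
    have hlip : PoissonEB.HolderOnReal ε 1 (fun x => f x - P.eval x) (Icc 0 h) := by
      intro x hx y hy
      rw [Real.rpow_one]
      refine Convex.norm_image_sub_le_of_norm_hasDerivWithin_le (f := fun x => f x - P.eval x)
        (f' := fun x => derivWithin f (Icc 0 h) x - q.eval x) (fun z hz => ?_) hq
        (convex_Icc 0 h) hy hx
      have h1 := (hdiff z hz).hasDerivWithinAt
      have h2 := P.hasDerivWithinAt z (Icc 0 h)
      rw [hP] at h2
      exact h1.sub h2
    obtain ⟨P', hPd', hP'⟩ := H' ε _ hε0 hlip N hN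
    refine ⟨P + P', (natDegree_add_le _ _).trans (max_le (by omega) (by omega)), fun x hx => ?_⟩
    rw [eval_add, ← sub_sub]
    refine (hP' x hx).trans (le_of_eq ?_)
    have e : (N : ℝ) ^ (-(((p + 1 : ℕ) : ℝ) + α)) = (N : ℝ) ^ (-(p + α)) * (N : ℝ) ^ (-1 : ℝ) := by
      rw [← Real.rpow_add hN0]
      congr 1
      push_cast
      ring
    rw [e, hε]
    ring

end Polynomial

namespace PoissonEB

/-! ### The critical index -/

lemma exists_le_pow_self (n : ℕ) : ∃ K : ℕ, n ≤ K ^ K := by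
  refine ⟨n, ?_⟩
  rcases Nat.eq_zero_or_pos n with rfl | h
  · simp
  · exact Nat.le_self_pow h.ne' n

open Classical in
/-- The least `K` with `n ≤ K ^ K`. It is of the order `log n / log log n`. -/
noncomputable def criticalIndex (n : ℕ) : ℕ := Nat.find (exists_le_pow_self n)

lemma le_criticalIndex_pow (n : ℕ) : n ≤ criticalIndex n ^ criticalIndex n :=
  Nat.find_spec (exists_le_pow_self n)

lemma pow_self_lt_of_lt_criticalIndex {n j : ℕ} (hj : j < criticalIndex n) : j ^ j < n :=
  not_le.1 (Nat.find_min (exists_le_pow_self n) hj)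

lemma tendsto_criticalIndex : Tendsto criticalIndex atTop atTop := by
  refine tendsto_atTop.2 fun K => ?_
  filter_upwards [eventually_gt_atTop (K ^ K + 1)] with n hn
  by_contra! h
  have h1 := le_criticalIndex_pow n
  have h2 : criticalIndex n ^ criticalIndex n ≤ K ^ K + 1 := by
    rcases Nat.eq_zero_or_pos (criticalIndex n) with h0 | h0
    · rw [h0]; simp
    · calc criticalIndex n ^ criticalIndex n ≤ K ^ criticalIndex n := Nat.pow_le_pow_left h.le _
        _ ≤ K ^ K := Nat.pow_le_pow_right (by omega) h.le
        _ ≤ _ := Nat.le_succ _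
  omega

lemma succ_pow_le_three_mul (j : ℕ) : ((j : ℝ) + 1) ^ j ≤ 3 * (j : ℝ) ^ j := by
  rcases Nat.eq_zero_or_pos j with rfl | hj
  · norm_num
  have hj' : (0 : ℝ) < j := by exact_mod_cast hj
  have h1 : ((j : ℝ) + 1) = j * (1 + (j : ℝ)⁻¹) := by field_simp
  have h2 : (1 + (j : ℝ)⁻¹) ^ j ≤ 3 := by
    have h3 : 1 + (j : ℝ)⁻¹ ≤ Real.exp (j : ℝ)⁻¹ := by
      linarith [Real.add_one_le_exp ((j : ℝ)⁻¹)]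
    have h4 : (1 + (j : ℝ)⁻¹) ^ j ≤ Real.exp (j : ℝ)⁻¹ ^ j :=
      pow_le_pow_left₀ (by positivity) h3 j
    rw [← Real.exp_nat_mul, mul_inv_cancel₀ hj'.ne'] at h4
    linarith [Real.exp_one_lt_d9]
  rw [h1, mul_pow]
  nlinarith [pow_pos hj' j]

/-- Minimality gives `j ^ j < n` for `j = κ - 1`, and `(1 + 1/j) ^ j < 3`. So `κ ^ κ` agrees with
`n` up to a factor `3 κ`. -/
lemma criticalIndex_pow_le {n : ℕ} (h : 1 ≤ criticalIndex n) :
    (criticalIndex n : ℝ) ^ criticalIndex n ≤ 3 * criticalIndex n * n := by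
  obtain ⟨j, hj⟩ : ∃ j, criticalIndex n = j + 1 := ⟨criticalIndex n - 1, by omega⟩
  have h1 : ((j : ℝ)) ^ j ≤ n := by
    exact_mod_cast (pow_self_lt_of_lt_criticalIndex (by omega : j < criticalIndex n)).le
  have h2 := succ_pow_le_three_mul j
  rw [hj]
  push_cast
  rw [pow_succ]
  have h3 : (0 : ℝ) ≤ j := by positivity
  nlinarith

lemma tendsto_log_natCast : Tendsto (fun n : ℕ => Real.log n) atTop atTop :=
  Real.tendsto_log_atTop.comp tendsto_natCast_atTop_atTop

lemma tendsto_log_log_natCast : Tendsto (fun n : ℕ => Real.log (Real.log n)) atTop atTop :=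
  Real.tendsto_log_atTop.comp tendsto_log_natCast

lemma eventually_div_log_log_le_criticalIndex :
    ∀ᶠ n : ℕ in atTop, Real.log n / Real.log (Real.log n) ≤ criticalIndex n := by
  filter_upwards [tendsto_log_log_natCast.eventually_ge_atTop 1,
    tendsto_log_natCast.eventually_gt_atTop 0, tendsto_criticalIndex.eventually_ge_atTop 1,
    eventually_gt_atTop 0] with n hs hy hκ hn
  by_contra! h
  have h1 : Real.log n ≤ criticalIndex n * Real.log (criticalIndex n) := by
    rw [← Real.log_pow]
    exact Real.log_le_log (by exact_mod_cast hn) (by exact_mod_cast le_criticalIndex_pow n)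
  have hs0 : 0 < Real.log (Real.log n) := by linarith
  have hκ' : (1 : ℝ) ≤ criticalIndex n := by exact_mod_cast hκ
  have h2 : (criticalIndex n : ℝ) ≤ Real.log n := h.le.trans (div_le_self hy.le hs)
  have h3 := Real.log_le_log (by linarith) h2
  rw [lt_div_iff₀ hs0] at h
  nlinarith

/-- Write `y = log n`, `s = log y`, `j = κ - 1`. Were the bound false, `j > 2 y / s ≥ √y`, so `log j
≥ s / 2` and `j log j > y`, against `j ^ j < n`. -/
lemma eventually_criticalIndex_le :
    ∀ᶠ n : ℕ in atTop, (criticalIndex n : ℝ) ≤ 4 * (Real.log n / Real.log (Real.log n)) := by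
  filter_upwards [tendsto_log_log_natCast.eventually_ge_atTop 1,
    tendsto_log_natCast.eventually_gt_atTop 0, tendsto_criticalIndex.eventually_ge_atTop 2]
    with n hs hy hκ
  by_contra! h
  obtain ⟨j, hj⟩ : ∃ j, criticalIndex n = j + 1 := ⟨criticalIndex n - 1, by omega⟩
  set y := Real.log n with hydef
  set s := Real.log y with hsdef
  have hs0 : 0 < s := by linarith
  have hj1 : (1 : ℝ) ≤ j := by exact_mod_cast (by omega : 1 ≤ j)
  have h1 : j * Real.log j ≤ y := by
    rw [← Real.log_pow]
    refine Real.log_le_log (by positivity) ?_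
    exact_mod_cast (pow_self_lt_of_lt_criticalIndex (by omega : j < criticalIndex n)).le
  have h2 : 2 * (y / s) < j := by
    rw [hj] at h
    push_cast at h
    linarith
  have h3 : s ≤ 2 * √y := by
    have h4 : s = 2 * Real.log √y := by rw [Real.log_sqrt hy.le]; ring
    have h5 := Real.log_le_sub_one_of_pos (Real.sqrt_pos.2 hy)
    linarith
  have h4 : √y ≤ 2 * (y / s) := by
    rw [← mul_div_assoc, le_div_iff₀ hs0]
    nlinarith [Real.mul_self_sqrt hy.le, Real.sqrt_nonneg y]
  have h5 : s / 2 ≤ Real.log j := by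
    rw [hsdef, ← Real.log_sqrt hy.le]
    exact Real.log_le_log (Real.sqrt_pos.2 hy) (h4.trans h2.le)
  have h6 : 2 * (y / s) * (s / 2) = y := by field_simp
  nlinarith

/-! ### Bounds in terms of the critical index -/

lemma ascFactorial_succ_le_two_mul_pow {K m : ℕ} (hm : m ≤ K) :
    ((K + 1).ascFactorial m : ℝ) ≤ (2 * K) ^ m := by
  have h1 := Nat.ascFactorial_le_pow_add K m
  have h2 : (K + m) ^ m ≤ (2 * K) ^ m := Nat.pow_le_pow_left (by omega) m
  exact_mod_cast h1.trans h2

lemma varianceProxy_le {b : ℕ → ℝ} {k : ℕ} {h : ℝ} {K : ℕ} {A D : ℝ} (hk : k ≤ K)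
    (hK : 1 ≤ K) (hA : 0 ≤ A) (hD : 1 ≤ D) (hb : ∀ m ≤ k, b m ^ 2 * h ^ m ≤ A * D ^ m) :
    varianceProxy b k h K ≤ A * (4 * D * K) ^ k := by
  have hK' : (1 : ℝ) ≤ K := by exact_mod_cast hK
  calc varianceProxy b k h K ≤ ∑ m ∈ Finset.range (k + 1), A * (2 * D * K) ^ k := by
        refine Finset.sum_le_sum fun m hm => ?_
        have hmk : m ≤ k := Nat.lt_succ_iff.1 (Finset.mem_range.1 hm)
        calc b m ^ 2 * h ^ m * (K + 1).ascFactorial m ≤ A * D ^ m * (2 * K) ^ m := by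
              refine mul_le_mul (hb m hmk) (ascFactorial_succ_le_two_mul_pow (hmk.trans hk))
                (by positivity) (by positivity)
          _ = A * (2 * D * K) ^ m := by rw [mul_assoc, ← mul_pow]; ring
          _ ≤ A * (2 * D * K) ^ k := by
              refine mul_le_mul_of_nonneg_left (pow_le_pow_right₀ ?_ hmk) hA
              nlinarith
    _ = A * (((k + 1 : ℕ) : ℝ) * (2 * D * K) ^ k) := by
        rw [Finset.sum_const, Finset.card_range, nsmul_eq_mul]; ring
    _ ≤ A * (2 ^ k * (2 * D * K) ^ k) := by
        have : ((k + 1 : ℕ) : ℝ) ≤ 2 ^ k := by exact_mod_cast Nat.lt_two_pow_self (n := k)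
        gcongr
    _ = A * (4 * D * K) ^ k := by rw [← mul_pow]; ring

lemma three_mul_le_four_pow {K : ℕ} (hK : 3 ≤ K) : (3 * K * (K + 1) : ℝ) ≤ 4 ^ K := by
  induction K, hK using Nat.le_induction with
  | base => norm_num
  | succ K hK ih =>
    have : (3 : ℝ) ≤ K := by exact_mod_cast hK
    rw [pow_succ]
    push_cast
    nlinarith

/-- For degrees at most half the critical index the variance is negligible. -/
lemma eventually_succ_mul_pow_le {B γ : ℝ} (hB : 1 ≤ B) (hγ : 0 < γ) (hγ1 : γ ≤ 1) :
    ∀ᶠ n : ℕ in atTop, ∀ k, 2 * k ≤ criticalIndex n →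
      ((criticalIndex n : ℝ) + 1) * (B * criticalIndex n) ^ k ≤ n * γ ^ criticalIndex n := by
  have htend := tendsto_natCast_atTop_atTop (R := ℝ).comp tendsto_criticalIndex
  filter_upwards [htend.eventually_ge_atTop (16 * (B / γ) ^ 2),
    tendsto_criticalIndex.eventually_ge_atTop 3] with n h1 h3 k hk
  simp only [Function.comp] at h1
  have hup := criticalIndex_pow_le (n := n) (by omega)
  have hfour := three_mul_le_four_pow h3
  set κ := criticalIndex n with hκ
  have hκ0 : (0 : ℝ) < κ := by exact_mod_cast (by omega : 0 < κ)
  have hBγ : 1 ≤ B / γ := by rw [one_le_div hγ]; linarith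
  obtain ⟨j, hj⟩ : ∃ j, κ = k + j := ⟨κ - k, by omega⟩
  -- Since `k ≤ κ / 2`, the unused exponent `j = κ - k` is at least `κ / 2`, and `κ ^ j` then beats
  -- any fixed exponential in `κ`.
  have h5 : (4 : ℝ) ^ κ * (B / γ) ^ κ ≤ (κ : ℝ) ^ j := by
    calc (4 : ℝ) ^ κ * (B / γ) ^ κ ≤ 4 ^ (2 * j) * (B / γ) ^ (2 * j) := by
          gcongr
          · norm_num
          · omega
          · omega
      _ = (16 * (B / γ) ^ 2) ^ j := by
          rw [mul_pow, ← pow_mul, pow_mul]; norm_num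
      _ ≤ (κ : ℝ) ^ j := pow_le_pow_left₀ (by positivity) h1 j
  have h6 : (4 : ℝ) ^ κ * (B * κ) ^ k ≤ γ ^ κ * (κ : ℝ) ^ κ := by
    calc (4 : ℝ) ^ κ * (B * κ) ^ k = 4 ^ κ * B ^ k * κ ^ k := by rw [mul_pow]; ring
      _ ≤ 4 ^ κ * B ^ κ * κ ^ k := by gcongr; omega
      _ = γ ^ κ * (4 ^ κ * (B / γ) ^ κ) * κ ^ k := by rw [div_pow]; field_simp
      _ ≤ γ ^ κ * κ ^ j * κ ^ k := by gcongr
      _ = γ ^ κ * (κ : ℝ) ^ κ := by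
          have : (κ : ℝ) ^ κ = κ ^ k * κ ^ j := by rw [← pow_add, ← hj]
          rw [this]; ring
  refine le_of_mul_le_mul_left (a := 3 * (κ : ℝ)) ?_ (by positivity)
  calc 3 * (κ : ℝ) * ((κ + 1) * (B * κ) ^ k) = 3 * κ * (κ + 1) * (B * κ) ^ k := by ring
    _ ≤ 4 ^ κ * (B * κ) ^ k := by gcongr
    _ ≤ γ ^ κ * (κ : ℝ) ^ κ := h6
    _ ≤ γ ^ κ * (3 * κ * n) := by gcongr
    _ = _ := by ring

lemma pow_succ_div_factorial_le {h γ : ℝ} (hh : 0 ≤ h) (hγ : 0 < γ) (hγ1 : γ ≤ 1) (K : ℕ) :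
    h ^ (K + 1) / (K + 1).factorial ≤ Real.exp (h / γ) * γ ^ K := by
  have h1 := Real.pow_div_factorial_le_exp (h / γ) (by positivity) (K + 1)
  calc h ^ (K + 1) / (K + 1).factorial = (h / γ) ^ (K + 1) / (K + 1).factorial * γ ^ (K + 1) := by
        rw [div_pow]; field_simp
    _ ≤ Real.exp (h / γ) * γ ^ (K + 1) := by gcongr
    _ ≤ Real.exp (h / γ) * γ ^ K := by
        gcongr ?_ * ?_
        exact pow_le_pow_of_le_one hγ.le hγ1 (Nat.le_succ K)

/-- The regret bound when the approximating polynomial has degree at most half the critical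
index. -/
lemma eventually_regretBound_of_approx {h B γ : ℝ} (hh : 0 < h) (hB : 1 ≤ B) (hγ : 0 < γ)
    (hγ1 : γ ≤ 1) : ∀ᶠ n : ℕ in atTop, ∀ (ℓ : ℝ → ℝ) (b : ℕ → ℝ) (k : ℕ) (M ε A : ℝ),
      0 ≤ A → ContinuousOn ℓ (Icc 0 h) → 2 * k ≤ criticalIndex n →
      (∀ θ ∈ Icc 0 h, |∑ m ∈ Finset.range (k + 1), b m * θ ^ m| ≤ M) →
      (∀ θ ∈ Icc 0 h, |ℓ θ - ∑ m ∈ Finset.range (k + 1), b m * θ ^ m| ≤ ε) →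
      varianceProxy b k h (criticalIndex n) ≤ A * (B * criticalIndex n) ^ k →
      RegretBound h ℓ n (2 * n * ε ^ 2 +
        (48 * M ^ 2 + 16 * A + 8 * M ^ 2 * Real.exp (h / γ)) * (n * γ ^ criticalIndex n)) := by
  filter_upwards [eventually_succ_mul_pow_le hB hγ hγ1, eventually_ge_atTop 2,
    tendsto_criticalIndex.eventually_ge_atTop 1] with n h1 h2 hκ ℓ b k M ε A hA hℓ hk hM hε hS
  refine (regretBound_of_approx hh hℓ b k hM hε (criticalIndex n) h2).mono ?_
  have h3 := h1 k hk
  have h4 := pow_succ_div_factorial_le hh.le hγ hγ1 (criticalIndex n)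
  set κ := criticalIndex n
  have hκ' : (1 : ℝ) ≤ κ := by exact_mod_cast hκ
  have h5 : 1 ≤ (B * κ) ^ k := one_le_pow₀ (by nlinarith)
  have h6 : ((κ : ℝ) + 1) * (48 * M ^ 2 + 16 * varianceProxy b k h κ) ≤
      (48 * M ^ 2 + 16 * A) * (n * γ ^ κ) := by
    calc ((κ : ℝ) + 1) * (48 * M ^ 2 + 16 * varianceProxy b k h κ)
        ≤ (κ + 1) * ((48 * M ^ 2 + 16 * A) * (B * κ) ^ k) := by
          gcongr
          nlinarith [sq_nonneg M]
      _ = (48 * M ^ 2 + 16 * A) * ((κ + 1) * (B * κ) ^ k) := by ring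
      _ ≤ _ := by gcongr
  have h7 : 8 * M ^ 2 * n * (h ^ (κ + 1) / (κ + 1).factorial) ≤
      8 * M ^ 2 * n * (Real.exp (h / γ) * γ ^ κ) := by gcongr
  nlinarith

/-- A bound valid for large `n`, uniformly over a bounded class of functions, holds for all `n ≥ 3`
after enlarging the constant. -/
lemma exists_forall_regretBound {h M C : ℝ} (hh : 0 < h) {𝓕 : Set (ℝ → ℝ)} {ρ : ℕ → ℝ}
    (hρ : ∀ n, 3 ≤ n → 0 < ρ n) (hc : ∀ ℓ ∈ 𝓕, ContinuousOn ℓ (Icc 0 h))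
    (hM : ∀ ℓ ∈ 𝓕, ∀ θ ∈ Icc 0 h, |ℓ θ| ≤ M)
    (H : ∀ᶠ n : ℕ in atTop, ∀ ℓ ∈ 𝓕, RegretBound h ℓ n (C * ρ n)) :
    ∃ C' : ℝ, 0 < C' ∧ ∀ ℓ ∈ 𝓕, ∀ n, 3 ≤ n → RegretBound h ℓ n (C' * ρ n) := by
  obtain ⟨N, hN⟩ := eventually_atTop.1 H
  -- For the finitely many small `n` the zero polynomial is used, with error `M` and regret bound `2
  -- n M²`; `S` dominates all the resulting ratios.
  set S := ∑ n ∈ Finset.Ico 3 N, 2 * n * M ^ 2 / ρ n with hS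
  have hterm : ∀ n ∈ Finset.Ico 3 N, 0 ≤ 2 * n * M ^ 2 / ρ n := fun n hn => by
    have := hρ n (Finset.mem_Ico.1 hn).1
    positivity
  have hS0 : 0 ≤ S := Finset.sum_nonneg hterm
  refine ⟨|C| + S + 1, by positivity, fun ℓ hℓ n hn => ?_⟩
  have hρn := hρ n hn
  rcases lt_or_ge n N with hnN | hnN
  · have h1 := regretBound_of_approx hh (hc ℓ hℓ) (fun _ => 0) 0 (M := 0) (ε := M) (by simp)
      (by simpa using hM ℓ hℓ) 0 (by omega : 2 ≤ n)
    refine h1.mono ?_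
    have h2 : 2 * n * M ^ 2 / ρ n ≤ S :=
      Finset.single_le_sum hterm (Finset.mem_Ico.2 ⟨hn, hnN⟩)
    rw [div_le_iff₀ hρn] at h2
    have h3 : varianceProxy (fun _ => 0) 0 h 0 = 0 := by simp [varianceProxy]
    rw [h3]
    have := abs_nonneg C
    nlinarith
  · refine (hN n hnN ℓ hℓ).mono (mul_le_mul_of_nonneg_right ?_ hρn.le)
    linarith [le_abs_self C]

lemma log_pos_of_three_le {n : ℕ} (hn : 3 ≤ n) : 1 < Real.log n := by
  have h1 : (3 : ℝ) ≤ n := by exact_mod_cast hn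
  rw [Real.lt_log_iff_exp_lt (by linarith)]
  linarith [Real.exp_one_lt_d9]

/-! ### Smooth functions -/

lemma eventually_half_pow_le_rpow (s : ℝ) :
    ∀ᶠ K : ℕ in atTop, (1 / 2 : ℝ) ^ K ≤ (K : ℝ) ^ (-s) := by
  have h1 := (tendsto_rpow_mul_exp_neg_mul_atTop_nhds_zero s (Real.log 2)
    (Real.log_pos one_lt_two)).comp (tendsto_natCast_atTop_atTop (R := ℝ))
  filter_upwards [h1.eventually_le_const one_pos, eventually_gt_atTop 0] with K hK hK0
  have hK0' : (0 : ℝ) < K := by exact_mod_cast hK0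
  simp only [Function.comp] at hK
  have h2 : Real.exp (-Real.log 2 * K) = (1 / 2) ^ K := by
    rw [mul_comm, Real.exp_nat_mul, Real.exp_neg, Real.exp_log two_pos, one_div]
  rw [h2] at hK
  rw [Real.rpow_neg hK0'.le, ← one_div, le_div_iff₀ (Real.rpow_pos_of_pos hK0' s), mul_comm]
  exact hK

theorem exists_regretBound_of_contDiffOn {h : ℝ} (hh : 0 < h) (p : ℕ) {α : ℝ} (hα : 0 < α)
    (hα1 : α ≤ 1) (L M : ℝ) : ∃ C : ℝ, 0 < C ∧
      ∀ ℓ : ℝ → ℝ, (∀ θ ∈ Icc (0 : ℝ) h, |ℓ θ| ≤ M) → ContDiffOn ℝ p ℓ (Icc 0 h) →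
        HolderOnReal L α (iteratedDerivWithin p ℓ (Icc 0 h)) (Icc 0 h) →
        ∀ n : ℕ, 3 ≤ n → RegretBound h ℓ n
          (C * n * (Real.log (Real.log n) / Real.log n) ^ (2 * ((p : ℝ) + α))) := by
  set β : ℝ := p + α with hβ
  have hβ0 : 0 < β := by positivity
  set ρ : ℕ → ℝ := fun n => n * (Real.log (Real.log n) / Real.log n) ^ (2 * β) with hρ
  obtain ⟨CJ, hCJ, HJ⟩ := Polynomial.exists_natDegree_le_abs_sub_eval_le hh hα hα1 p
  set E := CJ * |L| with hE
  have hE0 : 0 ≤ E := by positivity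
  set M' := |M| + E + 1 with hM'
  have hM'0 : 0 < M' := by positivity
  -- Squaring the coefficient bound `M' (4/h)^m e^k` and multiplying by `h ^ m` gives `M'² (16/h)^m
  -- e^(2k)`; the factor `e^(2k)` goes into the base `B`.
  set D := max 1 (16 / h) with hD
  set B := 4 * (D * Real.exp 2) with hB
  have hD1 : 1 ≤ D := le_max_left _ _
  have hDe : 1 ≤ D * Real.exp 2 := by
    have := Real.add_one_le_exp 2
    nlinarith
  set 𝓕 : Set (ℝ → ℝ) := {ℓ | (∀ θ ∈ Icc (0 : ℝ) h, |ℓ θ| ≤ M) ∧ ContDiffOn ℝ p ℓ (Icc 0 h) ∧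
    HolderOnReal L α (iteratedDerivWithin p ℓ (Icc 0 h)) (Icc 0 h)} with h𝓕
  set C₁ := 2 * (E * (64 : ℝ) ^ β) ^ 2 with hC₁
  set C₂ := 48 * M' ^ 2 + 16 * M' ^ 2 + 8 * M' ^ 2 * Real.exp (h / (1 / 2)) with hC₂
  have hev : ∀ᶠ n : ℕ in atTop, ∀ ℓ ∈ 𝓕, RegretBound h ℓ n ((C₁ + C₂) * ρ n) := by
    filter_upwards [eventually_regretBound_of_approx hh (B := B) (γ := 1 / 2) (by linarith)
      (by norm_num) (by norm_num), tendsto_criticalIndex.eventually_ge_atTop (4 * p + 64),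
      tendsto_criticalIndex.eventually (eventually_half_pow_le_rpow (2 * β)),
      eventually_div_log_log_le_criticalIndex, eventually_ge_atTop 3,
      tendsto_log_log_natCast.eventually_ge_atTop 1] with n h1 h2 h3 h4 hn3 hs ℓ hℓ
    obtain ⟨hℓM, hℓd, hℓH⟩ := hℓ
    set κ := criticalIndex n with hκ
    -- The degree `8 N + p` is at most `κ / 2` once `κ ≥ 4 p`, and still `N ≥ κ / 64`.
    set N := κ / 32 with hN
    have hN1 : 1 ≤ N := by omega
    have hN64 : (κ : ℝ) / 64 ≤ N := by
      have : κ ≤ 64 * N := by omega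
      have : (κ : ℝ) ≤ 64 * N := by exact_mod_cast this
      linarith
    have hκ0 : (0 : ℝ) < κ := by exact_mod_cast (by omega : 0 < κ)
    have hN0 : (0 : ℝ) < N := by exact_mod_cast hN1
    have hℓH' : HolderOnReal |L| α (iteratedDerivWithin p ℓ (Icc 0 h)) (Icc 0 h) :=
      fun x hx y hy => (hℓH x hx y hy).trans
        (mul_le_mul_of_nonneg_right (le_abs_self L) (by positivity))
    obtain ⟨P, hPd, hP⟩ := HJ |L| ℓ (abs_nonneg L) hℓd hℓH' N hN1
    rw [← hE, ← hβ] at hP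
    set k := 8 * N + p with hk
    set ε := E * (N : ℝ) ^ (-β) with hε
    have hε1 : ε ≤ E := by
      have : (N : ℝ) ^ (-β) ≤ 1 :=
        Real.rpow_le_one_of_one_le_of_nonpos (by exact_mod_cast hN1) (by linarith)
      nlinarith
    have hPM : ∀ θ ∈ Icc 0 h, |P.eval θ| ≤ M' := by
      intro θ hθ
      have e1 := hP θ hθ
      have e2 := hℓM θ hθ
      have e3 := abs_sub_abs_le_abs_sub (P.eval θ) (ℓ θ)
      rw [abs_sub_comm] at e3
      linarith [le_abs_self M]
    have heval : ∀ θ, ∑ m ∈ Finset.range (k + 1), P.coeff m * θ ^ m = P.eval θ := fun θ =>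
      (Polynomial.eval_eq_sum_range' (Nat.lt_succ_of_le hPd) θ).symm
    have hcoef : ∀ m ≤ k, P.coeff m ^ 2 * h ^ m ≤ (M' ^ 2 * Real.exp 2 ^ k) * D ^ m := by
      intro m _
      have e1 := Polynomial.abs_coeff_le_of_abs_eval_le hh hM'0 hPd hPM m
      have e2 : P.coeff m ^ 2 ≤ (M' * (4 / h) ^ m * Real.exp k) ^ 2 := by
        rw [← sq_abs]; exact pow_le_pow_left₀ (abs_nonneg _) e1 2
      have e3 : Real.exp k ^ 2 = Real.exp 2 ^ k := by
        rw [← Real.exp_nat_mul, ← Real.exp_nat_mul]; congr 1; push_cast; ring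
      calc P.coeff m ^ 2 * h ^ m ≤ (M' * (4 / h) ^ m * Real.exp k) ^ 2 * h ^ m := by gcongr
        _ = M' ^ 2 * Real.exp k ^ 2 * (((4 / h) ^ 2 * h) ^ m) := by
            rw [mul_pow ((4 / h) ^ 2), ← pow_mul, mul_comm 2 m, pow_mul]; ring
        _ = M' ^ 2 * Real.exp 2 ^ k * (16 / h) ^ m := by
            rw [e3]; congr 2; field_simp; norm_num
        _ ≤ _ := by gcongr; exact le_max_right _ _
    have hS : varianceProxy P.coeff k h κ ≤ M' ^ 2 * (B * κ) ^ k := by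
      refine (varianceProxy_le (by omega) (by omega) (by positivity) hD1 hcoef).trans (le_of_eq ?_)
      rw [hB, mul_assoc, ← mul_pow]
      ring
    refine (h1 ℓ P.coeff k M' ε (M' ^ 2) (by positivity) hℓd.continuousOn (by omega)
      (fun θ hθ => by rw [heval]; exact hPM θ hθ) (fun θ hθ => by rw [heval]; exact hP θ hθ)
      hS).mono ?_
    have hs0 : 0 < Real.log (Real.log n) := by linarith
    have hy := log_pos_of_three_le hn3
    have hκρ : (κ : ℝ) ^ (-(2 * β)) ≤ (Real.log (Real.log n) / Real.log n) ^ (2 * β) := by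
      rw [← inv_div, Real.inv_rpow (by positivity), ← Real.rpow_neg (by positivity)]
      exact Real.rpow_le_rpow_of_nonpos (by positivity) h4 (by linarith)
    have hε2 : ε ≤ E * (64 : ℝ) ^ β * (κ : ℝ) ^ (-β) := by
      have e1 : (N : ℝ) ^ (-β) ≤ ((κ : ℝ) / 64) ^ (-β) :=
        Real.rpow_le_rpow_of_nonpos (by positivity) hN64 (by linarith)
      have e2 : ((κ : ℝ) / 64) ^ (-β) = 64 ^ β * (κ : ℝ) ^ (-β) := by
        rw [Real.div_rpow hκ0.le (by norm_num), Real.rpow_neg (by norm_num : (0 : ℝ) ≤ 64)]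
        field_simp
      rw [hε, mul_assoc E (64 ^ β), ← e2]
      gcongr
    have hε3 : ε ^ 2 ≤ (E * (64 : ℝ) ^ β) ^ 2 * (κ : ℝ) ^ (-(2 * β)) := by
      have e1 : ((κ : ℝ) ^ (-β)) ^ 2 = (κ : ℝ) ^ (-(2 * β)) := by
        rw [← Real.rpow_natCast, ← Real.rpow_mul hκ0.le]; congr 1; push_cast; ring
      rw [← e1, ← mul_pow]
      exact pow_le_pow_left₀ (by positivity) hε2 2
    have hC₂0 : 0 ≤ C₂ := by positivity
    calc 2 * n * ε ^ 2 + C₂ * (n * (1 / 2) ^ κ)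
        ≤ 2 * n * ((E * (64 : ℝ) ^ β) ^ 2 * (κ : ℝ) ^ (-(2 * β))) +
            C₂ * (n * (κ : ℝ) ^ (-(2 * β))) := by gcongr
      _ = (C₁ + C₂) * (n * (κ : ℝ) ^ (-(2 * β))) := by rw [hC₁]; ring
      _ ≤ (C₁ + C₂) * ρ n := mul_le_mul_of_nonneg_left
          (mul_le_mul_of_nonneg_left hκρ (Nat.cast_nonneg n)) (by positivity)
  have hρpos : ∀ n, 3 ≤ n → 0 < ρ n := by
    intro n hn
    have h1 := log_pos_of_three_le hn
    have h2 := Real.log_pos h1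
    have h3 : (0 : ℝ) < n := by exact_mod_cast (by omega : 0 < n)
    rw [hρ]
    have := Real.rpow_pos_of_pos (div_pos h2 (by linarith : 0 < Real.log n)) (2 * β)
    positivity
  obtain ⟨C, hC, H⟩ := exists_forall_regretBound hh hρpos
    (fun ℓ (hℓ : ℓ ∈ 𝓕) => hℓ.2.1.continuousOn) (fun ℓ hℓ => hℓ.1) hev
  refine ⟨C, hC, fun ℓ h1 h2 h3 n hn => ?_⟩
  rw [mul_assoc]
  exact H ℓ ⟨h1, h2, h3⟩ n hn

/-! ### Power series -/

lemma HasPowerSeriesOnIcc.continuousOn {ℓ : ℝ → ℝ} {a : ℕ → ℝ} {h : ℝ} (hh : 0 ≤ h)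
    (H : HasPowerSeriesOnIcc ℓ a h) : ContinuousOn ℓ (Icc 0 h) := by
  have h1 : Summable fun m => |a m * h ^ m| := (H h ⟨hh, le_rfl⟩).summable.abs
  have h2 : ContinuousOn (fun θ => ∑' m, a m * θ ^ m) (Icc 0 h) := by
    refine continuousOn_tsum (fun m => by fun_prop) h1 fun m θ hθ => ?_
    rw [Real.norm_eq_abs, abs_mul, abs_mul, abs_of_nonneg (pow_nonneg hθ.1 m),
      abs_of_nonneg (pow_nonneg hh m)]
    exact mul_le_mul_of_nonneg_left (pow_le_pow_left₀ hθ.1 hθ.2 m) (abs_nonneg _)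
  exact h2.congr fun θ hθ => (H θ hθ).tsum_eq.symm

lemma abs_sub_sum_range_le_of_geometric {f : ℕ → ℝ} {s c q : ℝ} (hf : HasSum f s) (k : ℕ)
    (hq : 0 ≤ q) (hq1 : q < 1) (hc : ∀ i, |f (i + k)| ≤ c * q ^ i) :
    |s - ∑ m ∈ Finset.range k, f m| ≤ c / (1 - q) := by
  have h1 := (hasSum_nat_add_iff' k).2 hf
  rw [← h1.tsum_eq]
  exact tsum_of_norm_bounded (f := fun i => f (i + k))
    ((hasSum_geometric_of_lt_one hq hq1).mul_left c) hc

/-- The series converges at some `t ≥ r`, so its terms there, being differences of partial sums,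
tend to zero and are bounded. -/
lemma bddAbove_of_lt_convergenceRadius {a : ℕ → ℝ} {r : ℝ} (hr : 0 ≤ r)
    (H : ENNReal.ofReal r < convergenceRadius a) : BddAbove (range fun m => |a m| * r ^ m) := by
  obtain ⟨t, ht⟩ := lt_iSup_iff.1 H
  obtain ⟨⟨s, hs⟩, hrt⟩ := lt_iSup_iff.1 ht
  have hrt' : r ≤ t := by
    rw [ENNReal.ofReal_lt_coe_iff hr] at hrt
    exact hrt.le
  have h0 : Tendsto (fun m => a m * (t : ℝ) ^ m) atTop (𝓝 0) := by
    have h1 := (hs.comp (tendsto_add_atTop_nat 1)).sub hs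
    rw [sub_self] at h1
    refine h1.congr fun N => ?_
    simp [Finset.sum_range_succ]
  obtain ⟨B, hB⟩ := h0.abs.bddAbove_range
  refine ⟨B, ?_⟩
  rintro _ ⟨m, rfl⟩
  have h1 : |a m * (t : ℝ) ^ m| ≤ B := hB ⟨m, rfl⟩
  rw [abs_mul, abs_of_nonneg (by positivity : 0 ≤ (t : ℝ) ^ m)] at h1
  exact (mul_le_mul_of_nonneg_left (pow_le_pow_left₀ hr hrt' m) (abs_nonneg _)).trans h1

/-- The bound for the class of power series with `|aₘ| rᵐ ≤ A`. -/
theorem exists_regretBound_of_abs_coeff_le {h r : ℝ} (hh : 0 < h) (hr : h < r) (A : ℝ) :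
    ∃ C : ℝ, 0 < C ∧ ∀ (ℓ : ℝ → ℝ) (a : ℕ → ℝ), HasPowerSeriesOnIcc ℓ a h →
      (∀ m, |a m| * r ^ m ≤ A) → ∀ n : ℕ, 3 ≤ n →
      RegretBound h ℓ n (C * (n : ℝ) ^ (1 - Real.log (r / h) / Real.log (Real.log n))) := by
  have hr0 : 0 < r := hh.trans hr
  set γ := h / r with hγ
  have hγ0 : 0 < γ := by positivity
  have hγ1 : γ < 1 := by rw [hγ, div_lt_one hr0]; exact hr
  set 𝓕 : Set (ℝ → ℝ) := {ℓ | ∃ a, HasPowerSeriesOnIcc ℓ a h ∧ ∀ m, |a m| * r ^ m ≤ A} with h𝓕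
  set M := A / (1 - γ) with hM
  set D := max 1 (h / r ^ 2) with hD
  have hD1 : 1 ≤ D := le_max_left _ _
  have hterm : ∀ {a : ℕ → ℝ}, (∀ m, |a m| * r ^ m ≤ A) → ∀ θ ∈ Icc 0 h, ∀ m,
      |a m * θ ^ m| ≤ A * γ ^ m := by
    intro a ha θ hθ m
    rw [abs_mul, abs_of_nonneg (pow_nonneg hθ.1 m)]
    calc |a m| * θ ^ m ≤ |a m| * h ^ m :=
          mul_le_mul_of_nonneg_left (pow_le_pow_left₀ hθ.1 hθ.2 m) (abs_nonneg _)
      _ = |a m| * r ^ m * γ ^ m := by rw [hγ, div_pow]; field_simp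
      _ ≤ A * γ ^ m := mul_le_mul_of_nonneg_right (ha m) (by positivity)
  have hbound : ∀ ℓ ∈ 𝓕, ∀ θ ∈ Icc 0 h, |ℓ θ| ≤ M := by
    rintro ℓ ⟨a, hℓa, ha⟩ θ hθ
    simpa using abs_sub_sum_range_le_of_geometric (hℓa θ hθ) 0 hγ0.le hγ1
      (c := A) fun i => hterm ha θ hθ i
  set C₁ := 2 * M ^ 2 + (48 * M ^ 2 + 16 * A ^ 2 + 8 * M ^ 2 * Real.exp (h / γ)) with hC₁
  set ρ : ℕ → ℝ := fun n => (n : ℝ) ^ (1 - Real.log (r / h) / Real.log (Real.log n)) with hρ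
  have hev : ∀ᶠ n : ℕ in atTop, ∀ ℓ ∈ 𝓕, RegretBound h ℓ n (C₁ * ρ n) := by
    filter_upwards [eventually_regretBound_of_approx hh (B := 4 * D) (γ := γ) (by linarith)
      hγ0 hγ1.le, tendsto_criticalIndex.eventually_ge_atTop 1,
      eventually_div_log_log_le_criticalIndex, eventually_ge_atTop 3] with n h1 hκ1 h4 hn3
    rintro ℓ ⟨a, hℓa, ha⟩
    set κ := criticalIndex n with hκ
    -- The largest degree with negligible variance; the squared truncation error carries `γ ^ (2 (k
    -- + 1)) ≤ γ ^ κ`, rounding included.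
    set k := κ / 2 with hk
    have hA0 : 0 ≤ A := (by positivity : (0 : ℝ) ≤ |a 0| * r ^ 0).trans (ha 0)
    have hε : ∀ θ ∈ Icc 0 h, |ℓ θ - ∑ m ∈ Finset.range (k + 1), a m * θ ^ m| ≤
        M * γ ^ (k + 1) := by
      intro θ hθ
      refine (abs_sub_sum_range_le_of_geometric (hℓa θ hθ) (k + 1) hγ0.le hγ1
        (c := A * γ ^ (k + 1)) fun i => ?_).trans (le_of_eq ?_)
      · refine (hterm ha θ hθ _).trans (le_of_eq ?_)
        rw [pow_add]; ring
      · rw [hM]; ring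
    have hPM : ∀ θ ∈ Icc 0 h, |∑ m ∈ Finset.range (k + 1), a m * θ ^ m| ≤ M := by
      intro θ hθ
      refine (Finset.abs_sum_le_sum_abs _ _).trans ?_
      refine (Finset.sum_le_sum fun m _ => hterm ha θ hθ m).trans ?_
      rw [← Finset.mul_sum, hM, div_eq_mul_inv, ← tsum_geometric_of_lt_one hγ0.le hγ1]
      exact mul_le_mul_of_nonneg_left ((summable_geometric_of_lt_one hγ0.le hγ1).sum_le_tsum _
        fun m _ => by positivity) hA0
    have hcoef : ∀ m ≤ k, a m ^ 2 * h ^ m ≤ A ^ 2 * D ^ m := by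
      intro m _
      calc a m ^ 2 * h ^ m = (|a m| * r ^ m) ^ 2 * (h / r ^ 2) ^ m := by
            rw [mul_pow, sq_abs, div_pow, ← pow_mul, ← pow_mul, mul_comm 2 m]; field_simp
        _ ≤ A ^ 2 * D ^ m := by
            gcongr
            · exact ha m
            · exact le_max_right _ _
    have hS : varianceProxy a k h κ ≤ A ^ 2 * (4 * D * κ) ^ k :=
      varianceProxy_le (by omega) hκ1 (by positivity) hD1 hcoef
    refine (h1 ℓ a k M _ (A ^ 2) (by positivity) (hℓa.continuousOn hh.le) (by omega) hPM hε
      hS).mono ?_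
    have hγκ : (M * γ ^ (k + 1)) ^ 2 ≤ M ^ 2 * γ ^ κ := by
      rw [mul_pow, ← pow_mul]
      exact mul_le_mul_of_nonneg_left (pow_le_pow_of_le_one hγ0.le hγ1.le (by omega)) (sq_nonneg _)
    have hn0 : (0 : ℝ) < n := by exact_mod_cast (by omega : 0 < n)
    have hnγ : n * γ ^ κ ≤ ρ n := by
      rw [hρ]
      simp only
      rw [sub_eq_add_neg, Real.rpow_add hn0, Real.rpow_one]
      refine mul_le_mul_of_nonneg_left ?_ hn0.le
      have e1 : γ ^ κ = Real.exp (-(Real.log (r / h) * κ)) := by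
        rw [← Real.exp_log hγ0, ← Real.exp_nat_mul, hγ, ← inv_div r h, Real.log_inv]
        congr 1; ring
      rw [e1, Real.rpow_def_of_pos hn0]
      refine Real.exp_le_exp.2 ?_
      have e2 : 0 ≤ Real.log (r / h) := Real.log_nonneg (by rw [one_le_div hh]; exact hr.le)
      have e3 : Real.log n * -(Real.log (r / h) / Real.log (Real.log n)) =
          -(Real.log (r / h) * (Real.log n / Real.log (Real.log n))) := by ring
      rw [e3]
      exact neg_le_neg (mul_le_mul_of_nonneg_left h4 e2)
    calc 2 * n * (M * γ ^ (k + 1)) ^ 2 +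
          (48 * M ^ 2 + 16 * A ^ 2 + 8 * M ^ 2 * Real.exp (h / γ)) * (n * γ ^ κ)
        ≤ 2 * n * (M ^ 2 * γ ^ κ) +
          (48 * M ^ 2 + 16 * A ^ 2 + 8 * M ^ 2 * Real.exp (h / γ)) * (n * γ ^ κ) := by gcongr
      _ = C₁ * (n * γ ^ κ) := by rw [hC₁]; ring
      _ ≤ C₁ * ρ n := by gcongr
  have hρpos : ∀ n, 3 ≤ n → 0 < ρ n := fun n hn =>
    Real.rpow_pos_of_pos (by exact_mod_cast (by omega : 0 < n)) _
  have hcont : ∀ ℓ ∈ 𝓕, ContinuousOn ℓ (Icc 0 h) := fun ℓ ⟨a, hℓa, _⟩ => hℓa.continuousOn hh.le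
  obtain ⟨C, hC, H⟩ := exists_forall_regretBound hh hρpos hcont hbound hev
  exact ⟨C, hC, fun ℓ a h1 h2 n hn => H ℓ ⟨a, h1, h2⟩ n hn⟩

/-! ### Rapidly decaying coefficients -/

lemma pow_self_le_exp_mul_factorial (K : ℕ) : (K : ℝ) ^ K ≤ Real.exp K * K.factorial := by
  have h := Real.pow_div_factorial_le_exp (K : ℝ) (by positivity) K
  rwa [div_le_iff₀ (by positivity)] at h

/-- Split `K ^ m` into powers `d` and `1 - d`. The first is compared with `m ^ m` through `K ^ m ≤ e
^ K m! ≤ e ^ K m ^ m`, the second is largest at `m = K`. -/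
lemma rpow_neg_pow_mul_pow_le {K m : ℕ} {d : ℝ} (hm : 1 ≤ m) (hmK : m ≤ K) (hd : 0 ≤ d)
    (hd1 : d ≤ 1) :
    ((m : ℝ) ^ (-d)) ^ m * (K : ℝ) ^ m ≤ Real.exp K * ((K : ℝ) ^ K) ^ (1 - d) := by
  have hm0 : (0 : ℝ) < m := by exact_mod_cast hm
  have hK1 : (1 : ℝ) ≤ K := by exact_mod_cast hm.trans hmK
  have e1 : ((m : ℝ) ^ (-d)) ^ m = (((m : ℝ) ^ m) ^ d)⁻¹ := by
    rw [← Real.rpow_natCast, ← Real.rpow_natCast, ← Real.rpow_mul hm0.le, ← Real.rpow_mul hm0.le,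
      ← Real.rpow_neg hm0.le]
    congr 1; ring
  have h1 : (K : ℝ) ^ m ≤ Real.exp K * (m : ℝ) ^ m := by
    have h := Real.pow_div_factorial_le_exp (K : ℝ) (by positivity) m
    rw [div_le_iff₀ (by positivity)] at h
    refine h.trans (mul_le_mul_of_nonneg_left ?_ (Real.exp_pos _).le)
    exact_mod_cast Nat.factorial_le_pow m
  have h2 : ((K : ℝ) ^ m) ^ d ≤ Real.exp K * ((m : ℝ) ^ m) ^ d := by
    calc ((K : ℝ) ^ m) ^ d ≤ (Real.exp K * (m : ℝ) ^ m) ^ d :=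
          Real.rpow_le_rpow (by positivity) h1 hd
      _ = Real.exp K ^ d * ((m : ℝ) ^ m) ^ d := Real.mul_rpow (by positivity) (by positivity)
      _ ≤ Real.exp K ^ (1 : ℝ) * ((m : ℝ) ^ m) ^ d := by
          gcongr
          exact Real.one_le_exp (by positivity)
      _ = _ := by rw [Real.rpow_one]
  have h3 : ((K : ℝ) ^ m) ^ (1 - d) ≤ ((K : ℝ) ^ K) ^ (1 - d) :=
    Real.rpow_le_rpow (by positivity) (pow_le_pow_right₀ hK1 hmK) (by linarith)
  have hmd : 0 < ((m : ℝ) ^ m) ^ d := by positivity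
  rw [e1]
  calc (((m : ℝ) ^ m) ^ d)⁻¹ * (K : ℝ) ^ m
      = (((m : ℝ) ^ m) ^ d)⁻¹ * (((K : ℝ) ^ m) ^ d * ((K : ℝ) ^ m) ^ (1 - d)) := by
        rw [← Real.rpow_add (by positivity)]; simp
    _ ≤ (((m : ℝ) ^ m) ^ d)⁻¹ * ((Real.exp K * ((m : ℝ) ^ m) ^ d) * ((K : ℝ) ^ K) ^ (1 - d)) := by
        gcongr
    _ = _ := by field_simp

lemma criticalIndex_pow_rpow_le {n : ℕ} (hn : 1 ≤ criticalIndex n) {s : ℝ} (hs : 0 ≤ s)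
    (hs1 : s ≤ 1) :
    ((criticalIndex n : ℝ) ^ criticalIndex n) ^ s ≤ 3 * criticalIndex n * (n : ℝ) ^ s := by
  have hκ : (1 : ℝ) ≤ criticalIndex n := by exact_mod_cast hn
  calc ((criticalIndex n : ℝ) ^ criticalIndex n) ^ s ≤ (3 * criticalIndex n * n) ^ s :=
        Real.rpow_le_rpow (by positivity) (criticalIndex_pow_le hn) hs
    _ = (3 * criticalIndex n) ^ s * (n : ℝ) ^ s := Real.mul_rpow (by positivity) (by positivity)
    _ ≤ (3 * criticalIndex n) ^ (1 : ℝ) * (n : ℝ) ^ s := by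
        gcongr
        linarith
    _ = _ := by rw [Real.rpow_one]

lemma tendsto_mul_natCast_rpow_neg (G : ℝ) {D : ℝ} (hD : 0 < D) :
    Tendsto (fun m : ℕ => G * (m : ℝ) ^ (-D)) atTop (𝓝 0) := by
  simpa using ((tendsto_rpow_neg_atTop hD).comp
    (tendsto_natCast_atTop_atTop (R := ℝ))).const_mul G

lemma summable_mul_rpow_neg_pow {G D : ℝ} (hG : 0 ≤ G) (hD : 0 < D) :
    Summable fun m : ℕ => (G * (m : ℝ) ^ (-D)) ^ m := by
  refine Summable.of_norm_bounded_eventually_nat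
    (summable_geometric_of_lt_one (r := (1 / 2 : ℝ)) (by norm_num) (by norm_num)) ?_
  filter_upwards [(tendsto_mul_natCast_rpow_neg G hD).eventually_le_const
    (by norm_num : (0 : ℝ) < 1 / 2)] with m hm
  rw [Real.norm_of_nonneg (by positivity)]
  exact pow_le_pow_left₀ (by positivity) hm m

set_option maxHeartbeats 1000000 in
/-- The bound for power series without constant term and with rapidly decaying coefficients. -/
theorem exists_regretBound_of_rapidly_decaying {h D₁ D₂ : ℝ} (hh : 0 < h) (hD₁ : 0 < D₁)
    (hD₂ : 0 < D₂) : ∃ C₁ C₂ : ℝ, 0 < C₁ ∧ 0 < C₂ ∧ ∀ (ℓ : ℝ → ℝ) (a : ℕ → ℝ),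
      HasPowerSeriesOnIcc ℓ a h → a 0 = 0 →
      (∀ m : ℕ, 1 ≤ m → |a m| ≤ (D₁ * m) ^ (-(D₂ * m))) →
      ∀ n : ℕ, 3 ≤ n → RegretBound h ℓ n
        (C₁ * (n : ℝ) ^ (1 - min (2 * D₂) 1 + C₂ / Real.log (Real.log n))) := by
  set d := min (2 * D₂) 1 with hd
  have hd0 : 0 ≤ d := le_min (by positivity) zero_le_one
  have hd1 : d ≤ 1 := min_le_right _ _
  have hd2 : d ≤ 2 * D₂ := min_le_left _ _
  set E := D₁ ^ (-D₂) with hE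
  have hE0 : 0 < E := Real.rpow_pos_of_pos hD₁ _
  set w : ℕ → ℝ := fun m => (m : ℝ) ^ (-D₂) with hw
  have hw0 : ∀ m, 0 ≤ w m := fun m => by positivity
  set G := max 1 (E * h) with hG
  have hG1 : 1 ≤ G := le_max_left _ _
  set F := max 1 (E ^ 2 * h) with hF
  have hF1 : 1 ≤ F := le_max_left _ _
  have hu : Summable fun m : ℕ => (G * w m) ^ m := summable_mul_rpow_neg_pow (by linarith) hD₂
  have hu0 : ∀ m, 0 ≤ (G * w m) ^ m := fun m => by positivity
  set M := ∑' m : ℕ, (G * w m) ^ m with hM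
  -- One base dominating all exponentials in `κ`: `G ^ 2` from the squared error, `16 F e` from the
  -- variance, `e h` from the tail.
  set H := G ^ 2 + 16 * F * Real.exp 1 + Real.exp 1 * h with hH
  have hexp1 : 2 ≤ Real.exp 1 := by linarith [Real.add_one_le_exp 1]
  have hFe : 16 ≤ 16 * F * Real.exp 1 := by nlinarith
  have heh : 0 < Real.exp 1 * h := by positivity
  have hH1 : 1 < H := by nlinarith
  -- As `κ ≤ 4 log n / log log n`, this makes `H ^ κ ≤ n ^ (C₂ / log log n)`.
  set C₂ := 4 * Real.log H with hC₂
  have hlogH : 0 < Real.log H := Real.log_pos hH1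
  set ρ : ℕ → ℝ := fun n => (n : ℝ) ^ (1 - d + C₂ / Real.log (Real.log n)) with hρ
  set 𝓕 : Set (ℝ → ℝ) := {ℓ | ∃ a, HasPowerSeriesOnIcc ℓ a h ∧ a 0 = 0 ∧
    ∀ m : ℕ, 1 ≤ m → |a m| ≤ (D₁ * m) ^ (-(D₂ * m))} with h𝓕
  have hcoef : ∀ {a : ℕ → ℝ}, (∀ m : ℕ, 1 ≤ m → |a m| ≤ (D₁ * m) ^ (-(D₂ * m))) →
      ∀ m, 1 ≤ m → |a m| ≤ (E * w m) ^ m := by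
    intro a ha m hm
    refine (ha m hm).trans (le_of_eq ?_)
    rw [← neg_mul, Real.rpow_mul (by positivity), Real.rpow_natCast,
      Real.mul_rpow hD₁.le (by positivity)]
  have hterm : ∀ {a : ℕ → ℝ}, a 0 = 0 → (∀ m : ℕ, 1 ≤ m → |a m| ≤ (D₁ * m) ^ (-(D₂ * m))) →
      ∀ θ ∈ Icc 0 h, ∀ m, |a m * θ ^ m| ≤ (G * w m) ^ m := by
    intro a ha0 ha θ hθ m
    rcases Nat.eq_zero_or_pos m with rfl | hm
    · simp [ha0]
    rw [abs_mul, abs_of_nonneg (pow_nonneg hθ.1 m)]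
    calc |a m| * θ ^ m ≤ (E * w m) ^ m * h ^ m :=
          mul_le_mul (hcoef ha m hm) (pow_le_pow_left₀ hθ.1 hθ.2 m) (pow_nonneg hθ.1 m)
            (by positivity)
      _ = (E * h * w m) ^ m := by rw [← mul_pow]; ring
      _ ≤ (G * w m) ^ m := by
          have := hw0 m
          gcongr
          exact le_max_right _ _
  have hbound : ∀ ℓ ∈ 𝓕, ∀ θ ∈ Icc 0 h, |ℓ θ| ≤ M := by
    rintro ℓ ⟨a, hℓa, ha0, ha⟩ θ hθ
    rw [← (hℓa θ hθ).tsum_eq]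
    exact tsum_of_norm_bounded (f := fun m => a m * θ ^ m) hu.hasSum (hterm ha0 ha θ hθ)
  have hcont : ∀ ℓ ∈ 𝓕, ContinuousOn ℓ (Icc 0 h) := fun ℓ ⟨a, hℓa, _⟩ => hℓa.continuousOn hh.le
  have hρpos : ∀ n, 3 ≤ n → 0 < ρ n := fun n hn =>
    Real.rpow_pos_of_pos (by exact_mod_cast (by omega : 0 < n)) _
  set C := 8 + 48 * M ^ 2 + 16 + 8 * M ^ 2 * h with hC
  have hev : ∀ᶠ n : ℕ in atTop, ∀ ℓ ∈ 𝓕, RegretBound h ℓ n (C * ρ n) := by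
    filter_upwards [tendsto_criticalIndex.eventually_ge_atTop 3, eventually_criticalIndex_le,
      eventually_ge_atTop 3, tendsto_criticalIndex.eventually
      ((tendsto_mul_natCast_rpow_neg G hD₂).eventually_le_const (by norm_num : (0 : ℝ) < 1 / 2))]
      with n hκ3 hκle hn3 hGw
    rintro ℓ ⟨a, hℓa, ha0, ha⟩
    have hpow := le_criticalIndex_pow n
    have hXκ := criticalIndex_pow_rpow_le (n := n) (by omega) (s := 1 - d) (by linarith)
      (by linarith)
    have hfour := three_mul_le_four_pow hκ3
    set κ := criticalIndex n with hκ
    have hκ0 : (1 : ℝ) ≤ κ := by exact_mod_cast (by omega : 1 ≤ κ)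
    have hn0 : (1 : ℝ) ≤ n := by exact_mod_cast (by omega : 1 ≤ n)
    have hpow' : (n : ℝ) ≤ (κ : ℝ) ^ κ := by exact_mod_cast hpow
    set X := (n : ℝ) ^ (1 - d) with hX
    have hX1 : 1 ≤ X := Real.one_le_rpow hn0 (by linarith)
    have htwo : (κ : ℝ) + 1 ≤ 2 ^ κ := by exact_mod_cast Nat.lt_two_pow_self (n := κ)
    -- the approximation error
    have hGw0 : 0 ≤ G * w κ := by positivity
    set ε := (G * w κ) ^ κ / (1 - 1 / 2) with hε
    -- The degree is now `κ` rather than `κ / 2`: the decay of the coefficients offsets the growth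
    -- of the variance.
    have herr : ∀ θ ∈ Icc 0 h, |ℓ θ - ∑ m ∈ Finset.range (κ + 1), a m * θ ^ m| ≤ ε := by
      intro θ hθ
      refine abs_sub_sum_range_le_of_geometric (hℓa θ hθ) (κ + 1) (by norm_num) (by norm_num)
        fun i => (hterm ha0 ha θ hθ _).trans ?_
      have e1 : w (i + (κ + 1)) ≤ w κ := by
        refine Real.rpow_le_rpow_of_nonpos (by linarith) ?_ (by linarith)
        exact_mod_cast (by omega : κ ≤ i + (κ + 1))
      calc (G * w (i + (κ + 1))) ^ (i + (κ + 1)) ≤ (G * w κ) ^ (i + (κ + 1)) := by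
            have := hw0 (i + (κ + 1))
            gcongr
        _ = (G * w κ) ^ κ * (G * w κ) ^ (i + 1) := by rw [← pow_add]; congr 1; ring
        _ ≤ (G * w κ) ^ κ * (1 / 2) ^ (i + 1) := by
            gcongr
        _ ≤ (G * w κ) ^ κ * (1 / 2) ^ i := by
            refine mul_le_mul_of_nonneg_left ?_ (by positivity)
            exact pow_le_pow_of_le_one (by norm_num) (by norm_num) (Nat.le_succ i)
    have hε2 : n * ε ^ 2 ≤ 4 * (G ^ 2) ^ κ * X := by
      have e1 : (w κ ^ κ) ^ 2 ≤ (n : ℝ) ^ (-d) := by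
        have e2 : (w κ ^ κ) ^ 2 = ((κ : ℝ) ^ κ) ^ (-(2 * D₂)) := by
          simp only [hw]
          rw [← Real.rpow_natCast, ← Real.rpow_natCast, ← Real.rpow_natCast,
            ← Real.rpow_mul (by positivity), ← Real.rpow_mul (by positivity),
            ← Real.rpow_mul (by positivity)]
          congr 1; push_cast; ring
        rw [e2]
        exact (Real.rpow_le_rpow_of_nonpos (by linarith) hpow' (by linarith)).trans
          (Real.rpow_le_rpow_of_exponent_le hn0 (by linarith))
      have e3 : n * (n : ℝ) ^ (-d) = X := by
        rw [hX, sub_eq_add_neg, Real.rpow_add (by linarith), Real.rpow_one]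
      calc n * ε ^ 2 = 4 * (G ^ 2) ^ κ * (n * (w κ ^ κ) ^ 2) := by
            rw [hε, mul_pow, div_pow, mul_pow, ← pow_mul, mul_comm κ 2, pow_mul]; ring
        _ ≤ 4 * (G ^ 2) ^ κ * (n * (n : ℝ) ^ (-d)) := by gcongr
        _ = _ := by rw [e3]
    -- the variance
    have hS : varianceProxy a κ h κ ≤
        (κ + 1) * (F ^ κ * (2 ^ κ * (Real.exp κ * (3 * κ * X)))) := by
      calc varianceProxy a κ h κ
          ≤ ∑ m ∈ Finset.range (κ + 1), F ^ κ * (2 ^ κ * (Real.exp κ * (3 * κ * X))) := by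
            refine Finset.sum_le_sum fun m hm => ?_
            have hmκ : m ≤ κ := Nat.lt_succ_iff.1 (Finset.mem_range.1 hm)
            rcases Nat.eq_zero_or_pos m with rfl | hm0
            · rw [ha0]
              have : 0 ≤ F ^ κ * (2 ^ κ * (Real.exp κ * (3 * κ * X))) := by positivity
              simpa using this
            have e1 : w m ^ 2 ≤ (m : ℝ) ^ (-d) := by
              have hm1 : (1 : ℝ) ≤ m := by exact_mod_cast hm0
              simp only [hw]
              rw [← Real.rpow_natCast, ← Real.rpow_mul (by positivity)]
              exact Real.rpow_le_rpow_of_exponent_le hm1 (by push_cast; linarith)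
            have e2 : a m ^ 2 * h ^ m ≤ F ^ κ * ((m : ℝ) ^ (-d)) ^ m := by
              calc a m ^ 2 * h ^ m ≤ ((E * w m) ^ m) ^ 2 * h ^ m := by
                    rw [← sq_abs (a m)]
                    gcongr
                    exact hcoef ha m hm0
                _ = (E ^ 2 * h) ^ m * (w m ^ 2) ^ m := by
                    rw [← pow_mul, mul_comm m 2, pow_mul, ← mul_pow, ← mul_pow]; ring
                _ ≤ F ^ m * ((m : ℝ) ^ (-d)) ^ m := by
                    gcongr
                    exact le_max_right _ _
                _ ≤ F ^ κ * ((m : ℝ) ^ (-d)) ^ m := by gcongr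
            calc a m ^ 2 * h ^ m * (κ + 1).ascFactorial m
                ≤ F ^ κ * ((m : ℝ) ^ (-d)) ^ m * (2 * κ) ^ m :=
                  mul_le_mul e2 (ascFactorial_succ_le_two_mul_pow hmκ) (by positivity)
                    (by positivity)
              _ = F ^ κ * (2 ^ m * (((m : ℝ) ^ (-d)) ^ m * (κ : ℝ) ^ m)) := by
                  rw [mul_pow]; ring
              _ ≤ F ^ κ * (2 ^ κ * (Real.exp κ * ((κ : ℝ) ^ κ) ^ (1 - d))) := by
                  gcongr F ^ κ * (?_ * ?_)
                  · exact pow_le_pow_right₀ one_le_two hmκ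
                  · exact rpow_neg_pow_mul_pow_le hm0 hmκ hd0 hd1
              _ ≤ _ := by gcongr
        _ = _ := by
            rw [Finset.sum_const, Finset.card_range, nsmul_eq_mul]; push_cast; ring
    have hPM : ∀ θ ∈ Icc 0 h, |∑ m ∈ Finset.range (κ + 1), a m * θ ^ m| ≤ M := by
      intro θ hθ
      refine (Finset.abs_sum_le_sum_abs _ _).trans ?_
      refine (Finset.sum_le_sum fun m _ => hterm ha0 ha θ hθ m).trans ?_
      exact hu.sum_le_tsum _ fun m _ => hu0 m
    refine (regretBound_of_approx hh (hℓa.continuousOn hh.le) a κ hPM herr κ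
      (by omega : 2 ≤ n)).mono ?_
    -- collecting the terms
    have hexpκ : Real.exp κ = Real.exp 1 ^ κ := by rw [← Real.exp_nat_mul, mul_one]
    have hH0 : 0 < H := by linarith
    have t1 : 2 * n * ε ^ 2 ≤ 8 * (H ^ κ * X) := by
      have e1 : (G ^ 2) ^ κ ≤ H ^ κ :=
        pow_le_pow_left₀ (by positivity) (by linarith) κ
      calc 2 * n * ε ^ 2 = 2 * (n * ε ^ 2) := by ring
        _ ≤ 2 * (4 * (G ^ 2) ^ κ * X) := by gcongr
        _ ≤ 2 * (4 * H ^ κ * X) := by gcongr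
        _ = _ := by ring
    have t2 : ((κ : ℝ) + 1) * (48 * M ^ 2) ≤ 48 * M ^ 2 * (H ^ κ * X) := by
      have e1 : (2 : ℝ) ^ κ ≤ H ^ κ := pow_le_pow_left₀ (by norm_num) (by nlinarith) κ
      calc ((κ : ℝ) + 1) * (48 * M ^ 2) ≤ H ^ κ * (48 * M ^ 2) := by
            gcongr; exact htwo.trans e1
        _ = 48 * M ^ 2 * (H ^ κ * 1) := by ring
        _ ≤ _ := by gcongr
    have t3 : ((κ : ℝ) + 1) * (16 * varianceProxy a κ h κ) ≤ 16 * (H ^ κ * X) := by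
      calc ((κ : ℝ) + 1) * (16 * varianceProxy a κ h κ)
          ≤ (κ + 1) * (16 * ((κ + 1) * (F ^ κ * (2 ^ κ * (Real.exp κ * (3 * κ * X)))))) := by
            gcongr
        _ = 16 * ((κ + 1) * (3 * κ * (κ + 1)) * (F ^ κ * 2 ^ κ * Real.exp 1 ^ κ) * X) := by
            rw [hexpκ]; ring
        _ ≤ 16 * (2 ^ κ * 4 ^ κ * (F ^ κ * 2 ^ κ * Real.exp 1 ^ κ) * X) := by gcongr
        _ = 16 * ((16 * F * Real.exp 1) ^ κ * X) := by
            rw [show (16 * F * Real.exp 1) = 2 * 4 * (F * 2 * Real.exp 1) by ring, mul_pow,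
              mul_pow, mul_pow, mul_pow]
        _ ≤ 16 * (H ^ κ * X) := by
            gcongr
            nlinarith
    have t4 : 8 * M ^ 2 * n * (h ^ (κ + 1) / (κ + 1).factorial) ≤ 8 * M ^ 2 * h * (H ^ κ * X) := by
      have e1 : (n : ℝ) ≤ Real.exp κ * (κ + 1).factorial :=
        hpow'.trans ((pow_self_le_exp_mul_factorial κ).trans (mul_le_mul_of_nonneg_left
          (Nat.cast_le.2 (Nat.factorial_le (Nat.le_succ κ))) (Real.exp_pos _).le))
      have e2 : n * (h ^ (κ + 1) / (κ + 1).factorial) ≤ h * (Real.exp 1 * h) ^ κ := by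
        rw [← mul_div_assoc, div_le_iff₀ (by positivity)]
        calc n * h ^ (κ + 1) ≤ Real.exp κ * (κ + 1).factorial * h ^ (κ + 1) := by gcongr
          _ = _ := by rw [hexpκ, mul_pow]; ring
      have e3 : (Real.exp 1 * h) ^ κ ≤ H ^ κ :=
        pow_le_pow_left₀ (by positivity) (by nlinarith) κ
      calc 8 * M ^ 2 * n * (h ^ (κ + 1) / (κ + 1).factorial)
          = 8 * M ^ 2 * (n * (h ^ (κ + 1) / (κ + 1).factorial)) := by ring
        _ ≤ 8 * M ^ 2 * (h * (Real.exp 1 * h) ^ κ) := by gcongr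
        _ ≤ 8 * M ^ 2 * (h * H ^ κ) := by gcongr
        _ = 8 * M ^ 2 * h * (H ^ κ * 1) := by ring
        _ ≤ _ := by gcongr
    have hfinal : H ^ κ * X ≤ ρ n := by
      have hn0' : (0 : ℝ) < n := by linarith
      simp only [hρ]
      rw [Real.rpow_add hn0', mul_comm, ← hX]
      refine mul_le_mul_of_nonneg_left ?_ (by linarith)
      rw [Real.rpow_def_of_pos hn0', ← Real.exp_log (pow_pos hH0 κ), Real.log_pow]
      refine Real.exp_le_exp.2 ?_
      calc κ * Real.log H ≤ 4 * (Real.log n / Real.log (Real.log n)) * Real.log H := by gcongr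
        _ = _ := by rw [hC₂]; ring
    have hC0 : 0 ≤ C := by positivity
    refine le_trans ?_ (mul_le_mul_of_nonneg_left hfinal hC0)
    rw [hC]
    linarith
  obtain ⟨C', hC', HC⟩ := exists_forall_regretBound hh hρpos hcont hbound hev
  exact ⟨C', C₂, hC', by positivity, fun ℓ a h1 h2 h3 n hn => HC ℓ ⟨a, h1, h2, h3⟩ n hn⟩

end PoissonEB

/-! ### The three parts assembled -/

theorem mainTheorem3 :
    -- `ℓ` has a Hölder continuous derivative of order `p`
    (∀ (h : ℝ), 0 < h → ∀ (p : ℕ) (α : ℝ), 0 < α → α ≤ 1 → ∀ (L M : ℝ),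
      ∃ C : ℝ, 0 < C ∧
        ∀ ℓ : ℝ → ℝ, (∀ θ ∈ Set.Icc (0 : ℝ) h, |ℓ θ| ≤ M) →
          ContDiffOn ℝ p ℓ (Set.Icc 0 h) →
          PoissonEB.HolderOnReal L α (iteratedDerivWithin p ℓ (Set.Icc 0 h)) (Set.Icc 0 h) →
          ∀ n : ℕ, 3 ≤ n → PoissonEB.RegretBound h ℓ n
            (C * n * (Real.log (Real.log n) / Real.log n) ^ (2 * ((p : ℝ) + α)))) ∧
    -- `ℓ` is analytic with radius of convergence `R > h`
    (∀ (h : ℝ), 0 < h → ∀ R : ℝ≥0∞, ENNReal.ofReal h < R →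
      ∀ r : ℝ, h < r → ENNReal.ofReal r < R →
      ∃ C₂ : ℝ, 0 < C₂ ∧ ∃ C₁ : ℝ → ℝ, (∀ A, 0 < C₁ A) ∧
        ∀ (ℓ : ℝ → ℝ) (a : ℕ → ℝ), PoissonEB.HasPowerSeriesOnIcc ℓ a h →
          PoissonEB.convergenceRadius a = R →
          ∀ n : ℕ, 3 ≤ n → PoissonEB.RegretBound h ℓ n
            (C₁ (⨆ m, |a m| * r ^ m) * (n : ℝ) ^ (1 - C₂ / Real.log (Real.log n)))) ∧
    -- `ℓ` is analytic with rapidly decaying coefficients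
    (∀ (h : ℝ), 0 < h → ∀ D₁ : ℝ, 0 < D₁ → ∀ D₂ : ℝ, 0 < D₂ →
      ∃ C₁ C₂ : ℝ, 0 < C₁ ∧ 0 < C₂ ∧
        ∀ (ℓ : ℝ → ℝ) (a : ℕ → ℝ), PoissonEB.HasPowerSeriesOnIcc ℓ a h →
          (∀ m : ℕ, 1 ≤ m → |a m| ≤ (D₁ * m) ^ (-(D₂ * m))) →
          ∀ n : ℕ, 3 ≤ n → PoissonEB.RegretBound h ℓ n
            (C₁ * (n : ℝ) ^ (1 - min (2 * D₂) 1 + C₂ / Real.log (Real.log n)))) := by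
  refine ⟨fun h hh p α hα hα1 L M => PoissonEB.exists_regretBound_of_contDiffOn hh p hα hα1 L M,
    fun h hh R _ r hr hrR => ?_, fun h hh D₁ hD₁ D₂ hD₂ => ?_⟩
  -- The exponent constant `log (r / h)` does not depend on `A`, so only the prefactor becomes a
  -- function of `A`.
  · choose C₁ hC₁ H using PoissonEB.exists_regretBound_of_abs_coeff_le hh hr
    refine ⟨Real.log (r / h), Real.log_pos ((one_lt_div hh).2 hr), C₁, hC₁,
      fun ℓ a hℓ ha n hn => H _ ℓ a hℓ (fun m => ?_) n hn⟩
    exact le_ciSup (f := fun m => |a m| * r ^ m)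
      (PoissonEB.bddAbove_of_lt_convergenceRadius (hh.trans hr).le (ha ▸ hrR)) m
  · obtain ⟨C₁, C₂, hC₁, hC₂, H⟩ :=
      PoissonEB.exists_regretBound_of_rapidly_decaying hh hD₁ hD₂
    refine ⟨C₁, C₂, hC₁, hC₂, fun ℓ a hℓ ha n hn => .of_sub_const (a 0) ?_⟩
    -- The decay hypothesis says nothing about `a 0`, so the series of `ℓ - a 0` is used.
    refine H _ (fun m => if m = 0 then 0 else a m) (fun θ hθ => ?_) (if_pos rfl) (fun m hm => ?_)
      n hn
    · have h1 := (hℓ θ hθ).update 0 0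
      have e : Function.update (fun m => a m * θ ^ m) 0 0 =
          fun m => (if m = 0 then 0 else a m) * θ ^ m := by
        ext m
        rcases eq_or_ne m 0 with rfl | hm
        · simp
        · simp [hm]
      rw [e] at h1
      simpa [sub_eq_add_neg, add_comm] using h1
    · simpa [show m ≠ 0 by omega] using ha m hm
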